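/- **Conventions.** A dual number is $a=a_{\mathrm{st}}+a_{\mathcal I}\epsilon$ with $a_{\mathrm{st}},a_{\mathcal I}\in\mathbb R$, $\epsilon^2=0$; a dual quaternion is $\hat q=\tilde q_{\mathrm{st}}+\tilde q_{\mathcal I}\epsilon$ with quaternions $\tilde q_{\mathrm{st}},\tilde q_{\mathcal I}$, $\epsilon$ being central, and $\hat q^*=\tilde q_{\mathrm{st}}^*+\tilde q_{\mathcal I}^*\epsilon$. Convergence of dual numbers and of dual quaternion vectors means convergence of standard and dual parts. A vector is appreciable if its standard part is nonzero, and then $\|\hat{\mathbf x}\|_2=\sqrt{\hat{\mathbf x}^*\hat{\mathbf x}}$ is a dual number, where $\sqrt a=\sqrt{a_{\mathrm{st}}}+\frac{a_{\mathcal I}}{2\sqrt{a_{\mathrm{st}}}}\epsilon$; a unit vector is one with $\|\hat{\mathbf x}\|_2=1$, and a unit dual quaternion satisfies $\hat q^*\hat q=1$. Also $\|\hat{\mathbf x}\|_{2^R}=\sqrt{\|\tilde{\mathbf x}_{\mathrm{st}}\|_2^2+\|\tilde{\mathbf x}_{\mathcal I}\|_2^2}$. For a dual number, $|a|=|a_{\mathrm{st}}|+\operatorname{sgn}(a_{\mathrm{st}})a_{\mathcal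 I}\epsilon$ if $a_{\mathrm{st}}\ne0$, and $|a|=|a_{\mathcal I}|\epsilon$ otherwise. An eigenpair of $\hat A$ is a pair $(\lambda,\hat{\mathbf x})$ of a dual number $\lambda$ and an appreciable vector $\hat{\mathbf x}$ with $\hat A\hat{\mathbf x}=\hat{\mathbf x}\lambda$; then $\lambda$ is an eigenvalue. **Rayleigh quotient iteration.** Let $\|\hat{\mathbf u}_0\|_2=1$. For $k=0,1,2,\dots$ put $\hat\theta_k=\hat{\mathbf u}_k^*\hat A\hat{\mathbf u}_k$. If $\hat A-\hat\theta_kI$ is invertible, solve $(\hat A-\hat\theta_kI)\hat{\mathbf w}_{k+1}=\hat{\mathbf u}_k$ and put $\hat{\mathbf u}_{k+1}=\hat{\mathbf w}_{k+1}/\|\hat{\mathbf w}_{k+1}\|_2$. If it is singular, take for $\hat{\mathbf u}_{k+1}$ a unit vector with $(\hat A-\hat\theta_kI)\hat{\mathbf u}_{k+1}=\hat{\mathbf 0}$ and stop (the sequence is then continued as a constant). **Theorem.** Let $\hat A$ be an $n\times n$ dual quaternion Hermitian matrix ($\hat A^*=\hat A$), and let the Rayleigh quotient iteration be applied to $\hat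 A$ with a proper starting vector $\hat{\mathbf u}_0$, that is, a unit vector for which the iteration can be carried out (whenever $\hat A-\hat\theta_kI$ is singular, a unit vector as above exists) and for which the iterates remain bounded, $\sup_k\|\hat{\mathbf u}_k\|_{2^R}<\infty$. Then, as $k\to\infty$, one of the following holds. 1. $(\hat\theta_k,\hat{\mathbf u}_k)$ converges to an eigenpair of $\hat A$, the vectors being taken up to sign: there are an eigenpair $(\lambda,\hat{\mathbf x})$ with $\|\hat{\mathbf x}\|_2=1$ and signs $s_k\in\{1,-1\}$ such that $\hat\theta_k\to\lambda$ and $\hat{\mathbf u}_ks_k\to\hat{\mathbf x}$. 2. $\hat\theta_k$ converges to a dual number $\hat\theta$ that is equidistant from two eigenvalues $\lambda_1,\lambda_2$ of $\hat A$ with different standard parts, $|\hat\theta-\lambda_1|=|\hat\theta-\lambda_2|$, and $\{\hat{\mathbf u}_k\}$ does not converge, not even up to scalars: for no sequence of unit dual quaternions $\hat q_k$ does $\{\hat{\mathbf u}_k\hat q_k\}$ converge. -/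

import Mathlib

open Filter Topology
open scoped Quaternion Matrix

noncomputable section

/-- Dual quaternions `q_st + q_I ε`: Mathlib's dual numbers over the real quaternions.
The standard part is `q.fst`, the dual part is `q.snd`. -/
abbrev DQ : Type := DualNumber ℍ[ℝ]

/-- Conjugation of dual quaternions: `(q_st + q_I ε)* = q_st* + q_I* ε`. -/
instance DQ.instStar : Star DQ :=
  ⟨fun q => TrivSqZeroExt.inl (star q.fst) + TrivSqZeroExt.inr (star q.snd)⟩

/-- A dual number, seen as a dual quaternion. -/
def DQ.ofDual (a : DualNumber ℝ) : DQ :=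
  TrivSqZeroExt.inl (a.fst : ℍ[ℝ]) + TrivSqZeroExt.inr (a.snd : ℍ[ℝ])

/-- Absolute value of a dual number. -/
def dualAbs (a : DualNumber ℝ) : DualNumber ℝ :=
  if a.fst ≠ 0 then
    TrivSqZeroExt.inl |a.fst| + TrivSqZeroExt.inr (Real.sign a.fst * a.snd)
  else TrivSqZeroExt.inr |a.snd|

/-- Square root of a dual number with positive standard part:
`√a = √a_st + a_I / (2 √a_st) ε`. -/
def dualSqrt (a : DualNumber ℝ) : DualNumber ℝ :=
  TrivSqZeroExt.inl (Real.sqrt a.fst) + TrivSqZeroExt.inr (a.snd / (2 * Real.sqrt a.fst))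

open Classical in
/-- Magnitude of a dual quaternion, a dual number.
(`q_st q_I* + q_I q_st*` is a real quaternion, whence the real part.) -/
def DQ.magnitude (q : DQ) : DualNumber ℝ :=
  if q.fst ≠ 0 then
    TrivSqZeroExt.inl ‖q.fst‖ +
      TrivSqZeroExt.inr ((q.fst * star q.snd + q.snd * star q.fst).re / (2 * ‖q.fst‖))
  else TrivSqZeroExt.inr ‖q.snd‖

/-- Unit dual quaternions: `|q_st| = 1` and `q_st q_I* + q_I q_st* = 0`. -/
def DQ.IsUnitDQ (q : DQ) : Prop :=
  ‖q.fst‖ = 1 ∧ q.fst * star q.snd + q.snd * star q.fst = 0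

/-- A dual quaternion vector is appreciable if its standard part is nonzero. -/
def DQ.Appreciable {n : ℕ} (x : Fin n → DQ) : Prop := ∃ i, (x i).fst ≠ 0

open Classical in
/-- The `2`-norm of a dual quaternion vector, a dual number. -/
def DQ.norm2 {n : ℕ} (x : Fin n → DQ) : DualNumber ℝ :=
  if DQ.Appreciable x then dualSqrt (∑ i, DQ.magnitude (x i) ^ 2)
  else TrivSqZeroExt.inr (Real.sqrt (∑ i, ‖(x i).snd‖ ^ 2))

/-- The real-valued `2^R`-norm of a dual quaternion vector. -/
def DQ.norm2R {n : ℕ} (x : Fin n → DQ) : ℝ :=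
  Real.sqrt ((∑ i, ‖(x i).fst‖ ^ 2) + ∑ i, ‖(x i).snd‖ ^ 2)

/-- The matrix `A - θ I` for a dual number `θ`. -/
def DQ.shifted {n : ℕ} (A : Matrix (Fin n) (Fin n) DQ) (θ : DualNumber ℝ) :
    Matrix (Fin n) (Fin n) DQ :=
  A - Matrix.diagonal fun _ => DQ.ofDual θ

/-- `(lam, x)` is a (right) eigenpair of `A` with `lam` a dual number:
`x` is appreciable and `A x = x lam`. -/
def DQ.IsEigenpair {n : ℕ} (A : Matrix (Fin n) (Fin n) DQ) (lam : DualNumber ℝ)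
    (x : Fin n → DQ) : Prop :=
  DQ.Appreciable x ∧ A *ᵥ x = fun i => x i * DQ.ofDual lam

/-- The dual number `lam` is a (right) eigenvalue of `A`. -/
def DQ.IsEigenvalue {n : ℕ} (A : Matrix (Fin n) (Fin n) DQ) (lam : DualNumber ℝ) : Prop :=
  ∃ x, DQ.IsEigenpair A lam x

/-- `θ` and `u` are produced by the Rayleigh quotient iteration for `A`, started at the unit vector
`u 0` and run without tolerance or bound on the number of steps. If `A - θ_k I` is singular, then
`u (k + 1)` is a unit vector of its kernel and the algorithm stops, that is, the sequence is
constant from there on (in particular such a unit vector has to exist). -/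
structure DQ.IsRQI {n : ℕ} (A : Matrix (Fin n) (Fin n) DQ) (θ : ℕ → DualNumber ℝ)
    (u : ℕ → Fin n → DQ) : Prop where
  start : DQ.norm2 (u 0) = 1
  rayleigh : ∀ k, DQ.ofDual (θ k) = star (u k) ⬝ᵥ (A *ᵥ u k)
  step : ∀ k, IsUnit (DQ.shifted A (θ k)) →
    ∃ w : Fin n → DQ, DQ.shifted A (θ k) *ᵥ w = u k ∧
      u (k + 1) = fun i => w i * DQ.ofDual (DQ.norm2 w)⁻¹
  singularStep : ∀ k, ¬ IsUnit (DQ.shifted A (θ k)) →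
    DQ.shifted A (θ k) *ᵥ u (k + 1) = 0 ∧ DQ.norm2 (u (k + 1)) = 1 ∧
      ∀ m, k + 1 ≤ m → u m = u (k + 1)

end

/-! A singular step lands on an eigenvector whose Rayleigh quotient is the shift, so both sequences
are constant from then on. Suppose every step is regular. With the real part of the quaternionic
inner product, standard and dual parts of `A` become symmetric operators `A₀`, `A₁` on a real
Euclidean space. First-order perturbation theory gives a dual eigenbasis `e i + f i ε`, in which the
iteration is diagonal with eigenvalues `lam i + mu i ε` (`DualRQI.diag`).

The standard part is a classical Rayleigh quotient iteration. Its residuals decrease, so the inverse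
normalizing factors converge to some `τ ≥ 0` and the increments of `θ` vanish (`exists_tau`). The
coordinates satisfy `a k i * ((lam i - θ k) ^ 2 - τ ^ 2) → 0`, which drives `θ` to the finite set of
numbers `lam i ± τ`; having vanishing increments, it converges to some `t` (`exists_theta_limit`).

The dual part is controlled by the boundedness of the iterates. Within one standard eigenspace, the
ratios `b / a` of two coordinates drift apart at a rate proportional to the difference of their
`mu`; if the eigenspace keeps positive mass, boundedness forces all participating `mu` to agree
(`exists_class_data`). One bounded scalar `β` then describes the dual motion of the whole component.

If `τ = 0`, all mass goes to the eigenvalue `t`, `β → 0`, and the iterates converge up to sign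
(`converges_of_tau_eq_zero`). If `τ > 0`, the mass splits evenly between `t + τ` and `t - τ`; the
difference of the two `β` triples at each step up to a null sequence, so boundedness forces it to
zero, which places the dual part of the Rayleigh quotient at the midpoint (`midpoint_of_tau_pos`). A
limit `x` up to unit quaternions would then have residual `± τ x`, although residuals are orthogonal
to `x` (`not_tendsto_rightMul`). -/

/-- Rayleigh quotient iteration for the diagonal dual number matrix with entries
`lam i + mu i ε`, in coordinates `a k i + b k i ε`, with Rayleigh quotients `θ k + η k ε` and
normalizing factors `N k + M k ε`. All shifted matrices are nonsingular and the dual parts of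
the iterates are bounded by `C`. -/
structure DiagRQI {ι : Type*} [Fintype ι] (lam mu : ι → ℝ) (a b : ℕ → ι → ℝ)
    (θ η N M : ℕ → ℝ) (C : ℝ) : Prop where
  unit : ∀ k, ∑ i, a k i ^ 2 = 1
  orth : ∀ k, ∑ i, a k i * b k i = 0
  theta_eq : ∀ k, θ k = ∑ i, lam i * a k i ^ 2
  eta_eq : ∀ k, η k = ∑ i, (mu i * a k i ^ 2 + 2 * lam i * (a k i * b k i))
  pos : ∀ k, 0 < N k
  ne : ∀ k i, lam i - θ k ≠ 0
  step_a : ∀ k i, (lam i - θ k) * (N k * a (k + 1) i) = a k i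
  step_b : ∀ k i, (lam i - θ k) * (N k * b (k + 1) i + M k * a (k + 1) i) +
    (mu i - η k) * (N k * a (k + 1) i) = b k i
  bdd : ∀ k i, |b k i| ≤ C

/-! ### Real sequences: finite limit sets, increments and expanding recursions -/

/-- A sequence with steps tending to zero that approaches a finite set converges to one of its
points. -/
theorem exists_tendsto_of_approaches_finite {S : Set ℝ} (hS : S.Finite) {x : ℕ → ℝ}
    (hstep : Tendsto (fun k => x (k + 1) - x k) atTop (𝓝 0))
    (hclose : ∀ ε > 0, ∀ᶠ k in atTop, ∃ s ∈ S, |x k - s| < ε) :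
    ∃ s ∈ S, Tendsto x atTop (𝓝 s) := by
  -- `g` is the radius of a ball around `0` that misses the finite, hence closed, set of nonzero
  -- gaps of `S`.
  obtain ⟨g, hg, hsep⟩ : ∃ g > 0, ∀ s ∈ S, ∀ t ∈ S, |s - t| < g → s = t := by
    have hfin : ((fun p : ℝ × ℝ => |p.1 - p.2|) '' (S ×ˢ S) \ {0}).Finite :=
      ((hS.prod hS).image _).sdiff
    have h0 : (0 : ℝ) ∉ ((fun p : ℝ × ℝ => |p.1 - p.2|) '' (S ×ˢ S) \ {0}) := by simp
    obtain ⟨g, hg, hball⟩ := Metric.isOpen_iff.1 hfin.isClosed.isOpen_compl 0 h0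
    refine ⟨g, hg, fun s hs t ht hst => ?_⟩
    by_contra hne
    have hmem : |s - t| ∈ Metric.ball (0 : ℝ) g := by simpa using hst
    exact hball hmem ⟨⟨(s, t), ⟨hs, ht⟩, rfl⟩, by simpa [sub_eq_zero] using hne⟩
  have hstep' : ∀ᶠ k in atTop, |x (k + 1) - x k| < g / 4 := by
    have := (hstep.abs).eventually_lt_const (show |(0 : ℝ)| < g / 4 by simp; positivity)
    exact this
  obtain ⟨K, hK⟩ := ((hclose (g / 4) (by positivity)).and hstep').exists_forall_of_atTop
  obtain ⟨s, hs, hsK⟩ := (hK K le_rfl).1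
  have hall : ∀ k ≥ K, |x k - s| < g / 4 := by
    intro k hk
    induction k, hk using Nat.le_induction with
    | base => exact hsK
    | succ k hk ih =>
      obtain ⟨t, ht, htk⟩ := (hK (k + 1) (by omega)).1
      have h2 := (hK k hk).2
      -- Three distances below `g / 4` (from `t` to `x (k + 1)`, to `x k`, to `s`) add up to less
      -- than the minimal gap.
      have : t = s := by
        refine hsep t ht s hs ?_
        rw [abs_lt] at *
        constructor <;> linarith
      rwa [this] at htk
  refine ⟨s, hs, ?_⟩
  rw [Metric.tendsto_atTop]
  intro ε hε
  obtain ⟨K', hK'⟩ := (hclose (min ε (g / 4)) (by positivity)).exists_forall_of_atTop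
  refine ⟨max K K', fun k hk => ?_⟩
  obtain ⟨t, ht, htk⟩ := hK' k (le_trans (le_max_right _ _) hk)
  have h1 := hall k (le_trans (le_max_left _ _) hk)
  have h3 := lt_of_lt_of_le htk (min_le_right _ _)
  have : t = s := by
    refine hsep t ht s hs ?_
    rw [abs_lt] at *
    constructor <;> linarith
  rw [Real.dist_eq, ← this]
  exact lt_of_lt_of_le htk (min_le_left _ _)

/-- The increments of a bounded sequence can only converge to zero. -/
theorem eq_zero_of_tendsto_increment {x : ℕ → ℝ} {B L : ℝ} (hx : ∀ k, |x k| ≤ B)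
    (h : Tendsto (fun k => x (k + 1) - x k) atTop (𝓝 L)) : L = 0 := by
  -- Cesàro means of the increments telescope to `(x n - x 0) / n`, which vanishes for a bounded
  -- sequence.
  have h1 := h.cesaro
  simp only [Finset.sum_range_sub] at h1
  have h2 : Tendsto (fun n : ℕ => (n : ℝ)⁻¹ * (x n - x 0)) atTop (𝓝 0) := by
    have h0 : Tendsto (fun n : ℕ => (n : ℝ)⁻¹) atTop (𝓝 0) := tendsto_inv_atTop_nhds_zero_nat
    have := bdd_le_mul_tendsto_zero (f := fun n => x n - x 0) (b := -(2 * B)) (B := 2 * B)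
      (Eventually.of_forall fun n => by
        have := abs_le.1 (hx n); have := abs_le.1 (hx 0); linarith)
      (Eventually.of_forall fun n => by
        have := abs_le.1 (hx n); have := abs_le.1 (hx 0); linarith) h0
    simpa [mul_comm] using this
  exact tendsto_nhds_unique h1 h2

theorem tendsto_zero_of_sq_tendsto_zero {x : ℕ → ℝ}
    (h : Tendsto (fun k => x k ^ 2) atTop (𝓝 0)) : Tendsto x atTop (𝓝 0) := by
  have := (Real.continuous_sqrt.tendsto 0).comp h
  rw [Real.sqrt_zero] at this
  exact (tendsto_zero_iff_abs_tendsto_zero x).2 (this.congr fun k => Real.sqrt_sq_eq_abs _)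

/-- A bounded sequence with `x (k + 1) - 3 x k → 0` tends to zero. -/
theorem tendsto_zero_of_tripling {x : ℕ → ℝ} {B : ℝ} (hx : ∀ k, |x k| ≤ B)
    (h : Tendsto (fun k => x (k + 1) - 3 * x k) atTop (𝓝 0)) : Tendsto x atTop (𝓝 0) := by
  rw [Metric.tendsto_atTop]
  intro ε hε
  have hev : ∀ᶠ k in atTop, |x (k + 1) - 3 * x k| < ε :=
    h.abs.eventually_lt_const (by simpa using hε)
  obtain ⟨K, hK⟩ := hev.exists_forall_of_atTop
  refine ⟨K, fun k hk => ?_⟩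
  rw [Real.dist_eq, sub_zero]
  by_contra! hge
  -- Once `|x k| ≥ ε` while the error stays below `ε`, tripling leaves at least a doubling: `3 * ε *
  -- 2 ^ m - ε ≥ 2 * ε * 2 ^ m`.
  have hgrow : ∀ m : ℕ, ε * (2 : ℝ) ^ m ≤ |x (k + m)| := by
    intro m
    induction m with
    | zero => simpa using hge
    | succ m ih =>
      have h1 := hK (k + m) (by omega)
      have h2 : 3 * |x (k + m)| ≤ |x (k + m + 1)| + |x (k + m + 1) - 3 * x (k + m)| := by
        have h3 : |3 * x (k + m)| = 3 * |x (k + m)| := by rw [abs_mul]; norm_num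
        rw [← h3]
        have h4 := abs_sub (x (k + m + 1)) (x (k + m + 1) - 3 * x (k + m))
        rwa [sub_sub_cancel] at h4
      have h3 : ε ≤ ε * 2 ^ m := le_mul_of_one_le_right hε.le (one_le_pow₀ (by norm_num))
      rw [pow_succ, ← add_assoc]
      linarith
  obtain ⟨m, hm⟩ := pow_unbounded_of_one_lt (B / ε) (show (1 : ℝ) < 2 by norm_num)
  have h1 := hgrow m
  have h2 := hx (k + m)
  rw [div_lt_iff₀ hε] at hm
  linarith

/-! ### Standard part: monotone residuals -/

namespace DiagRQI

variable {ι : Type*} [Fintype ι] {lam mu : ι → ℝ} {a b : ℕ → ι → ℝ} {θ η N M : ℕ → ℝ} {C : ℝ}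

theorem abs_a_le_one (h : DiagRQI lam mu a b θ η N M C) (k : ℕ) (i : ι) : |a k i| ≤ 1 := by
  rw [← sq_le_one_iff_abs_le_one, ← h.unit k]
  exact Finset.single_le_sum (f := fun i => a k i ^ 2) (fun j _ => sq_nonneg _) (Finset.mem_univ i)

/-- The squared residual norm of the standard part. -/
def resid (lam : ι → ℝ) (a : ℕ → ι → ℝ) (θ : ℕ → ℝ) (k : ℕ) : ℝ :=
  ∑ i, (lam i - θ k) ^ 2 * a k i ^ 2

theorem sum_shift_sq_succ (h : DiagRQI lam mu a b θ η N M C) (k : ℕ) :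
    ∑ i, (lam i - θ k) ^ 2 * a (k + 1) i ^ 2 = (N k)⁻¹ ^ 2 := by
  have hN := (h.pos k).ne'
  rw [← mul_one ((N k)⁻¹ ^ 2), ← h.unit k, Finset.mul_sum]
  refine Finset.sum_congr rfl fun i _ => ?_
  rw [← h.step_a k i]
  field_simp

/-- The Rayleigh quotient is the best shift for its vector. Replacing it by the old shift `θ k`
raises the squared residual to `(N k)⁻¹ ^ 2`, and the excess is the squared change of shift. -/
theorem resid_succ (h : DiagRQI lam mu a b θ η N M C) (k : ℕ) :
    resid lam a θ (k + 1) = (N k)⁻¹ ^ 2 - (θ (k + 1) - θ k) ^ 2 := by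
  have h1 : resid lam a θ (k + 1) = ∑ i, (lam i - θ k) ^ 2 * a (k + 1) i ^ 2
      - 2 * (θ (k + 1) - θ k) * ∑ i, lam i * a (k + 1) i ^ 2
      + (θ (k + 1) ^ 2 - θ k ^ 2) * ∑ i, a (k + 1) i ^ 2 := by
    rw [resid, Finset.mul_sum, Finset.mul_sum, ← Finset.sum_sub_distrib, ← Finset.sum_add_distrib]
    exact Finset.sum_congr rfl fun i _ => by ring
  rw [h1, h.sum_shift_sq_succ, h.unit, ← h.theta_eq]
  ring

/-- The inner product of the residual at step `k` with the next iterate is `(N k)⁻¹`, so this is the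
Cauchy–Schwarz defect of that pair. Together with `resid_succ` it traps `(N k)⁻¹ ^ 2` between
consecutive squared residuals. -/
theorem sum_defect_sq (h : DiagRQI lam mu a b θ η N M C) (k : ℕ) :
    ∑ i, ((lam i - θ k) * a k i - (N k)⁻¹ * a (k + 1) i) ^ 2 =
      resid lam a θ k - (N k)⁻¹ ^ 2 := by
  have hN := (h.pos k).ne'
  have h1 : ∑ i, ((lam i - θ k) * a k i - (N k)⁻¹ * a (k + 1) i) ^ 2 =
      resid lam a θ k - 2 * ∑ i, (lam i - θ k) ^ 2 * a (k + 1) i ^ 2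
        + (N k)⁻¹ ^ 2 * ∑ i, a (k + 1) i ^ 2 := by
    rw [resid, Finset.mul_sum, Finset.mul_sum, ← Finset.sum_sub_distrib, ← Finset.sum_add_distrib]
    refine Finset.sum_congr rfl fun i _ => ?_
    rw [← h.step_a k i]
    field_simp
    ring
  rw [h1, h.sum_shift_sq_succ, h.unit]
  ring

theorem inv_sq_le_resid (h : DiagRQI lam mu a b θ η N M C) (k : ℕ) :
    (N k)⁻¹ ^ 2 ≤ resid lam a θ k := by
  have h1 := h.sum_defect_sq k
  have h2 : 0 ≤ ∑ i, ((lam i - θ k) * a k i - (N k)⁻¹ * a (k + 1) i) ^ 2 :=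
    Finset.sum_nonneg fun i _ => sq_nonneg _
  linarith

theorem resid_antitone (h : DiagRQI lam mu a b θ η N M C) : Antitone (resid lam a θ) := by
  refine antitone_nat_of_succ_le fun k => ?_
  have h1 := h.resid_succ k
  have h2 := h.inv_sq_le_resid k
  nlinarith [sq_nonneg (θ (k + 1) - θ k)]

/-- Convergence of the normalizing factors: `1 / N k` tends to the limit of the residual norms. -/
theorem exists_tau (h : DiagRQI lam mu a b θ η N M C) :
    ∃ τ : ℝ, 0 ≤ τ ∧ Tendsto (fun k => (N k)⁻¹) atTop (𝓝 τ) ∧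
      Tendsto (fun k => θ (k + 1) - θ k) atTop (𝓝 0) ∧
      ∀ i, Tendsto (fun k => (lam i - θ k) * a k i - (N k)⁻¹ * a (k + 1) i) atTop (𝓝 0) := by
  have hbdd : BddBelow (Set.range (resid lam a θ)) := by
    refine ⟨0, ?_⟩
    rintro _ ⟨k, rfl⟩
    exact Finset.sum_nonneg fun i _ => by positivity
  have hR := tendsto_atTop_ciInf h.resid_antitone hbdd
  set ρ := ⨅ k, resid lam a θ k
  have hR' := (tendsto_add_atTop_iff_nat 1).2 hR
  have hN2 : Tendsto (fun k => (N k)⁻¹ ^ 2) atTop (𝓝 ρ) := by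
    refine tendsto_of_tendsto_of_tendsto_of_le_of_le hR' hR (fun k => ?_) h.inv_sq_le_resid
    have h1 := h.resid_succ k
    have h2 := sq_nonneg (θ (k + 1) - θ k)
    simp only
    linarith
  have hsqrt : Tendsto (fun k => (N k)⁻¹) atTop (𝓝 (Real.sqrt ρ)) := by
    refine ((Real.continuous_sqrt.tendsto ρ).comp hN2).congr fun k => ?_
    exact Real.sqrt_sq (inv_nonneg.2 (h.pos k).le)
  refine ⟨Real.sqrt ρ, Real.sqrt_nonneg _, hsqrt, ?_, fun i => ?_⟩
  · have h1 : Tendsto (fun k => (θ (k + 1) - θ k) ^ 2) atTop (𝓝 0) := by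
      have := hN2.sub hR'
      rw [sub_self] at this
      exact this.congr fun k => by rw [h.resid_succ]; ring
    exact (tendsto_zero_of_sq_tendsto_zero h1)
  · have h1 : Tendsto (fun k => resid lam a θ k - (N k)⁻¹ ^ 2) atTop (𝓝 0) := by
      simpa using hR.sub hN2
    have h2 : Tendsto (fun k => ((lam i - θ k) * a k i - (N k)⁻¹ * a (k + 1) i) ^ 2)
        atTop (𝓝 0) := by
      refine squeeze_zero (fun k => sq_nonneg _) (fun k => ?_) h1
      rw [← h.sum_defect_sq k]
      exact Finset.single_le_sum
        (f := fun i => ((lam i - θ k) * a k i - (N k)⁻¹ * a (k + 1) i) ^ 2)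
        (fun j _ => sq_nonneg _) (Finset.mem_univ i)
    exact (tendsto_zero_of_sq_tendsto_zero h2)

end DiagRQI

/-! ### Limit of the shifts and structure of the eigenspace components -/

namespace DiagRQI

variable {ι : Type*} [Fintype ι] {lam mu : ι → ℝ} {a b : ℕ → ι → ℝ} {θ η N M : ℕ → ℝ} {C : ℝ}

theorem bounded_shift (h : DiagRQI lam mu a b θ η N M C) (i : ι) :
    ∃ B, ∀ k, |lam i - θ k| ≤ B := by
  refine ⟨|lam i| + ∑ j, |lam j|, fun k => ?_⟩
  have h1 : |θ k| ≤ ∑ j, |lam j| := by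
    rw [h.theta_eq]
    refine (Finset.abs_sum_le_sum_abs _ _).trans (Finset.sum_le_sum fun j _ => ?_)
    rw [abs_mul, abs_of_nonneg (sq_nonneg (a k j))]
    have := (sq_le_one_iff_abs_le_one (a k j)).2 (h.abs_a_le_one k j)
    exact mul_le_of_le_one_right (abs_nonneg _) this
  have := abs_sub (lam i) (θ k)
  linarith

/-- Multiplying the defect by `lam i - θ k` and using the step equation turns `a (k + 1) i` back
into `a k i`: two steps of the iteration asymptotically preserve directions. -/
theorem tendsto_a_mul (h : DiagRQI lam mu a b θ η N M C) {τ : ℝ}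
    (hτ : Tendsto (fun k => (N k)⁻¹) atTop (𝓝 τ))
    (hdef : ∀ i, Tendsto (fun k => (lam i - θ k) * a k i - (N k)⁻¹ * a (k + 1) i) atTop (𝓝 0))
    (i : ι) : Tendsto (fun k => a k i * ((lam i - θ k) ^ 2 - τ ^ 2)) atTop (𝓝 0) := by
  obtain ⟨B, hB⟩ := h.bounded_shift i
  have h1 : Tendsto (fun k => (lam i - θ k) *
      ((lam i - θ k) * a k i - (N k)⁻¹ * a (k + 1) i)) atTop (𝓝 0) :=
    bdd_le_mul_tendsto_zero (Eventually.of_forall fun k => (abs_le.1 (hB k)).1)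
      (Eventually.of_forall fun k => (abs_le.1 (hB k)).2) (hdef i)
  have h2 : Tendsto (fun k => a k i * ((N k)⁻¹ ^ 2 - τ ^ 2)) atTop (𝓝 0) := by
    refine bdd_le_mul_tendsto_zero
      (Eventually.of_forall fun k => (abs_le.1 (h.abs_a_le_one k i)).1)
      (Eventually.of_forall fun k => (abs_le.1 (h.abs_a_le_one k i)).2) ?_
    have h0 := (hτ.pow 2).sub_const (τ ^ 2)
    rwa [sub_self] at h0
  have h3 := h1.add h2
  rw [add_zero] at h3
  refine h3.congr fun k => ?_
  have hN := (h.pos k).ne'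
  rw [← h.step_a k i]
  field_simp
  ring

/-- The standard parts of the Rayleigh quotients converge, and the limit has distance `τ` from
the spectrum. -/
theorem exists_theta_limit (h : DiagRQI lam mu a b θ η N M C) {τ : ℝ}
    (hτ : Tendsto (fun k => (N k)⁻¹) atTop (𝓝 τ))
    (hstep : Tendsto (fun k => θ (k + 1) - θ k) atTop (𝓝 0))
    (hdef : ∀ i, Tendsto (fun k => (lam i - θ k) * a k i - (N k)⁻¹ * a (k + 1) i) atTop (𝓝 0)) :
    ∃ t, Tendsto θ atTop (𝓝 t) := by
  have hS : (Set.range (fun i => lam i - τ) ∪ Set.range (fun i => lam i + τ)).Finite :=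
    (Set.finite_range _).union (Set.finite_range _)
  obtain ⟨s, -, hs⟩ := exists_tendsto_of_approaches_finite hS hstep fun ε hε => by
    have h1 : Tendsto (fun k => ∑ i, (a k i * ((lam i - θ k) ^ 2 - τ ^ 2)) ^ 2) atTop (𝓝 0) := by
      have := tendsto_finsetSum Finset.univ fun i _ => (h.tendsto_a_mul hτ hdef i).pow 2
      simpa using this
    filter_upwards [h1.eventually_lt_const (show 0 < ε ^ 4 by positivity)] with k hk
    by_contra! hfar
    -- A shift at distance at least `ε` from every `lam i ± τ` makes each factor `((lam i - θ k) ^ 2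
    -- - τ ^ 2) ^ 2` at least `ε ^ 4`, and the weights `a k i ^ 2` sum to one.
    have h2 : ε ^ 4 ≤ ∑ i, (a k i * ((lam i - θ k) ^ 2 - τ ^ 2)) ^ 2 := by
      calc ε ^ 4 = ∑ i, a k i ^ 2 * ε ^ 4 := by rw [← Finset.sum_mul, h.unit, one_mul]
        _ ≤ _ := Finset.sum_le_sum fun i _ => ?_
      have e1 : ε ≤ |θ k - (lam i - τ)| := hfar _ (Or.inl ⟨i, rfl⟩)
      have e2 : ε ≤ |θ k - (lam i + τ)| := hfar _ (Or.inr ⟨i, rfl⟩)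
      have e3 : ε ^ 2 ≤ (θ k - (lam i - τ)) ^ 2 := by
        rw [← sq_abs (θ k - (lam i - τ))]; gcongr
      have e4 : ε ^ 2 ≤ (θ k - (lam i + τ)) ^ 2 := by
        rw [← sq_abs (θ k - (lam i + τ))]; gcongr
      have e5 : ε ^ 2 * ε ^ 2 ≤ (θ k - (lam i - τ)) ^ 2 * (θ k - (lam i + τ)) ^ 2 := by gcongr
      calc a k i ^ 2 * ε ^ 4 = a k i ^ 2 * (ε ^ 2 * ε ^ 2) := by ring
        _ ≤ a k i ^ 2 * ((θ k - (lam i - τ)) ^ 2 * (θ k - (lam i + τ)) ^ 2) := by gcongr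
        _ = _ := by ring
    linarith
  exact ⟨s, hs⟩

theorem tendsto_a_zero (h : DiagRQI lam mu a b θ η N M C) {τ t : ℝ}
    (hτ : Tendsto (fun k => (N k)⁻¹) atTop (𝓝 τ)) (ht : Tendsto θ atTop (𝓝 t))
    (hdef : ∀ i, Tendsto (fun k => (lam i - θ k) * a k i - (N k)⁻¹ * a (k + 1) i) atTop (𝓝 0))
    {i : ι} (hi : (lam i - t) ^ 2 ≠ τ ^ 2) : Tendsto (fun k => a k i) atTop (𝓝 0) := by
  have h1 := h.tendsto_a_mul hτ hdef i
  have h2 : Tendsto (fun k => (lam i - θ k) ^ 2 - τ ^ 2) atTop (𝓝 ((lam i - t) ^ 2 - τ ^ 2)) :=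
    ((tendsto_const_nhds.sub ht).pow 2).sub_const _
  have hne : (lam i - t) ^ 2 - τ ^ 2 ≠ 0 := sub_ne_zero.2 hi
  have h3 := h1.div h2 hne
  rw [zero_div] at h3
  refine h3.congr' ?_
  filter_upwards [h2.eventually_ne hne] with k hk
  exact mul_div_cancel_right₀ _ hk

theorem exists_eta_bound (h : DiagRQI lam mu a b θ η N M C) : ∃ B, ∀ k, |η k| ≤ B := by
  refine ⟨∑ i, (|mu i| + 2 * |lam i| * C), fun k => ?_⟩
  rw [h.eta_eq]
  refine (Finset.abs_sum_le_sum_abs _ _).trans (Finset.sum_le_sum fun i _ => ?_)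
  have h1 := h.abs_a_le_one k i
  have h2 := (sq_le_one_iff_abs_le_one (a k i)).2 h1
  refine (abs_add_le _ _).trans (add_le_add ?_ ?_)
  · rw [abs_mul, abs_of_nonneg (sq_nonneg (a k i))]
    exact mul_le_of_le_one_right (abs_nonneg _) h2
  · rw [abs_mul, abs_mul, abs_mul, abs_two]
    have : |a k i| * |b k i| ≤ 1 * C := mul_le_mul h1 (h.bdd k i) (abs_nonneg _) zero_le_one
    rw [one_mul] at this
    gcongr

/-- The common real factor of the coordinates belonging to the standard eigenvalue `l`. -/
noncomputable def factor (l : ℝ) (θ N : ℕ → ℝ) (k : ℕ) : ℝ := ∏ j ∈ Finset.range k, (N j * (l - θ j))⁻¹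

theorem a_eq_factor (h : DiagRQI lam mu a b θ η N M C) (k : ℕ) (i : ι) :
    a k i = factor (lam i) θ N k * a 0 i := by
  induction k with
  | zero => simp [factor]
  | succ k ih =>
    have hN := (h.pos k).ne'
    have hd := h.ne k i
    have h1 := h.step_a k i
    rw [factor, Finset.prod_range_succ, ← factor, mul_right_comm, ← ih, ← h1]
    field_simp

theorem a_ne_zero (h : DiagRQI lam mu a b θ η N M C) {i : ι} (hi : a 0 i ≠ 0) (k : ℕ) :
    a k i ≠ 0 := by
  rw [h.a_eq_factor k i]
  refine mul_ne_zero (Finset.prod_ne_zero_iff.2 fun j _ => inv_ne_zero ?_) hi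
  exact mul_ne_zero (h.pos j).ne' (h.ne j i)

/-- Dividing by the standard coordinate makes the dual recursion additive. The unknown term `M k / N
k` is the same for all `i` and cancels in differences. -/
theorem ratio_succ (h : DiagRQI lam mu a b θ η N M C) {i : ι} (hi : a 0 i ≠ 0) (k : ℕ) :
    b (k + 1) i / a (k + 1) i =
      b k i / a k i - M k / N k - (mu i - η k) / (lam i - θ k) := by
  have hN := (h.pos k).ne'
  have hd := h.ne k i
  have ha := h.a_ne_zero hi (k + 1)
  rw [← h.step_b k i, ← h.step_a k i]
  field_simp
  ring

/-- Where the standard coordinate vanishes no ratio exists, but then the dual coordinate itself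
obeys the standard recursion. -/
theorem b_of_a_eq_zero (h : DiagRQI lam mu a b θ η N M C) {i : ι} (hi : a 0 i = 0) (k : ℕ) :
    b k i = factor (lam i) θ N k * b 0 i := by
  induction k with
  | zero => simp [factor]
  | succ k ih =>
    have hN := (h.pos k).ne'
    have hd := h.ne k i
    have ha : a (k + 1) i = 0 := by rw [h.a_eq_factor, hi, mul_zero]
    have h1 := h.step_b k i
    rw [ha] at h1
    rw [factor, Finset.prod_range_succ, ← factor, mul_right_comm, ← ih, ← h1]
    field_simp
    ring

open Classical in
/-- Squared norm of the component belonging to the standard eigenvalue `l`. -/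
noncomputable def mass (lam : ι → ℝ) (a : ℕ → ι → ℝ) (l : ℝ) (k : ℕ) : ℝ :=
  ∑ i with lam i = l, a k i ^ 2

open Classical in
/-- Dual part (halved) of the squared norm of the component belonging to the standard
eigenvalue `l`. -/
noncomputable def dualMass (lam : ι → ℝ) (a b : ℕ → ι → ℝ) (l : ℝ) (k : ℕ) : ℝ :=
  ∑ i with lam i = l, a k i * b k i

theorem mass_eq (h : DiagRQI lam mu a b θ η N M C) (l : ℝ) (k : ℕ) :
    mass lam a l k = factor l θ N k ^ 2 * mass lam a l 0 := by
  classical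
  rw [mass, mass, Finset.mul_sum]
  refine Finset.sum_congr rfl fun i hi => ?_
  rw [h.a_eq_factor k i, (Finset.mem_filter.1 hi).2]
  ring

/-- If the component belonging to the standard eigenvalue `l` keeps a positive mass, then all
its dual eigenvalues coincide and its coordinates have constant direction. -/
theorem exists_class_data (h : DiagRQI lam mu a b θ η N M C) {l m t : ℝ} (hm : 0 < m)
    (hmass : Tendsto (mass lam a l) atTop (𝓝 m)) (ht : Tendsto θ atTop (𝓝 t)) :
    ∃ (p : ℝ) (nu : ℝ) (β : ℕ → ℝ) (γ : ι → ℝ) (B : ℝ),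
      0 < p ∧ Tendsto (fun k => |factor l θ N k|) atTop (𝓝 p) ∧
      (∃ i, lam i = l ∧ mu i = nu ∧ a 0 i ≠ 0) ∧
      (∀ i, lam i = l → a 0 i ≠ 0 → mu i = nu) ∧
      (∀ k i, lam i = l → a 0 i ≠ 0 → b k i = (β k + γ i) * a k i) ∧
      (∀ k, β (k + 1) = β k - M k / N k - (nu - η k) / (l - θ k)) ∧
      (∀ k, β k * mass lam a l k = dualMass lam a b l k) ∧
      (∀ k, |β k| ≤ B) := by
  classical
  have hm0 : 0 < mass lam a l 0 := by
    refine lt_of_le_of_ne (Finset.sum_nonneg fun i _ => sq_nonneg _) fun h0 => ?_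
    have : Tendsto (mass lam a l) atTop (𝓝 0) :=
      tendsto_const_nhds.congr fun k => by rw [h.mass_eq l k, ← h0, mul_zero]
    exact hm.ne' (tendsto_nhds_unique hmass this)
  have hfac : Tendsto (fun k => |factor l θ N k|) atTop (𝓝 (Real.sqrt (m / mass lam a l 0))) := by
    refine ((Real.continuous_sqrt.tendsto _).comp
      (hmass.div_const (mass lam a l 0))).congr fun k => ?_
    simp only [Function.comp]
    rw [h.mass_eq l k, mul_div_cancel_right₀ _ hm0.ne', Real.sqrt_sq_eq_abs]
  have hp : 0 < Real.sqrt (m / mass lam a l 0) := Real.sqrt_pos.2 (div_pos hm hm0)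
  obtain ⟨i₀, hi₀, ha₀⟩ : ∃ i, lam i = l ∧ a 0 i ≠ 0 := by
    by_contra! hall
    refine hm0.ne' (Finset.sum_eq_zero fun i hi => ?_)
    rw [hall i (Finset.mem_filter.1 hi).2]; ring
  -- Positive limiting mass keeps `|a k i|` convergent to a positive limit, so bounded `b` gives
  -- bounded ratios.
  have hratio : ∀ i, lam i = l → a 0 i ≠ 0 → ∃ B, ∀ k, |b k i / a k i| ≤ B := by
    intro i hi ha
    have h1 : Tendsto (fun k => C * |a k i|⁻¹) atTop
        (𝓝 (C * (Real.sqrt (m / mass lam a l 0) * |a 0 i|)⁻¹)) := by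
      refine (Tendsto.inv₀ ?_ (mul_pos hp (abs_pos.2 ha)).ne').const_mul C
      refine (hfac.mul_const |a 0 i|).congr fun k => ?_
      rw [h.a_eq_factor k i, hi, abs_mul]
    obtain ⟨B, hB⟩ := h1.bddAbove_range
    refine ⟨B, fun k => le_trans ?_ (hB ⟨k, rfl⟩)⟩
    rw [abs_div, div_eq_mul_inv]
    exact mul_le_mul_of_nonneg_right (h.bdd k i) (inv_nonneg.2 (abs_nonneg _))
  have hsame : ∀ i, lam i = l → a 0 i ≠ 0 → mu i = mu i₀ := by
    intro i hi ha
    obtain ⟨B, hB⟩ := hratio i hi ha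
    obtain ⟨B₀, hB₀⟩ := hratio i₀ hi₀ ha₀
    set X : ℕ → ℝ := fun k => b k i / a k i - b k i₀ / a k i₀ with hX
    have hXb : ∀ k, |X k| ≤ B + B₀ := fun k => by
      have := hB k; have := hB₀ k
      exact (abs_sub _ _).trans (by linarith)
    -- A constant must equal the increment of a bounded sequence times `l - θ k`. If `θ → l` the
    -- product tends to zero; otherwise the increments converge, necessarily to zero. Either way the
    -- constant is zero.
    have hXs : ∀ k, (X (k + 1) - X k) * (l - θ k) = mu i₀ - mu i := by
      intro k
      have hd := h.ne k i
      simp only [hX, h.ratio_succ ha k, h.ratio_succ ha₀ k, hi, hi₀]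
      rw [hi] at hd
      field_simp
      ring
    have hd : Tendsto (fun k => l - θ k) atTop (𝓝 (l - t)) := tendsto_const_nhds.sub ht
    by_cases hD : l - t = 0
    · rw [hD] at hd
      have h1 : Tendsto (fun k => (X (k + 1) - X k) * (l - θ k)) atTop (𝓝 0) :=
        bdd_le_mul_tendsto_zero (b := -(2 * (B + B₀))) (B := 2 * (B + B₀))
          (Eventually.of_forall fun k => by
            have := abs_le.1 (hXb k); have := abs_le.1 (hXb (k + 1)); linarith)
          (Eventually.of_forall fun k => by
            have := abs_le.1 (hXb k); have := abs_le.1 (hXb (k + 1)); linarith) hd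
      have h2 := tendsto_nhds_unique (tendsto_const_nhds.congr fun k => (hXs k).symm) h1
      linarith
    · have h1 : Tendsto (fun k => X (k + 1) - X k) atTop (𝓝 ((mu i₀ - mu i) / (l - t))) := by
        refine (tendsto_const_nhds.div hd hD).congr fun k => ?_
        have hd' := h.ne k i
        rw [hi] at hd'
        change (mu i₀ - mu i) / (l - θ k) = _
        rw [← hXs k, mul_div_cancel_right₀ _ hd']
      have h2 := eq_zero_of_tendsto_increment hXb h1
      rw [div_eq_zero_iff, or_iff_left hD] at h2
      linarith
  set r : ℕ → ℝ := fun k => b k i₀ / a k i₀ with hr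
  set δ : ι → ℝ := fun i => b 0 i / a 0 i - r 0 with hδ
  have hb : ∀ k i, lam i = l → a 0 i ≠ 0 → b k i = (r k + δ i) * a k i := by
    intro k i hi ha
    have h1 : b k i / a k i = r k + δ i := by
      induction k with
      | zero => simp [hδ]
      | succ k ih =>
        simp only [hr] at ih ⊢
        rw [h.ratio_succ ha k, h.ratio_succ ha₀ k, ih, hsame i hi ha, hi, hi₀]
        ring
    rw [← h1, div_mul_cancel₀ _ (h.a_ne_zero ha k)]
  -- Shifting by the weighted mean `g` of the constant offsets makes `β` the mass-weighted mean of
  -- the ratios, whence `β * mass = dualMass`.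
  set g : ℝ := (∑ i with lam i = l, δ i * a 0 i ^ 2) / mass lam a l 0 with hg
  obtain ⟨B₀, hB₀⟩ := hratio i₀ hi₀ ha₀
  refine ⟨_, mu i₀, fun k => r k + g, fun i => δ i - g, B₀ + |g|, hp, hfac,
    ⟨i₀, hi₀, rfl, ha₀⟩, hsame, fun k i hi ha => ?_, fun k => ?_, fun k => ?_, fun k => ?_⟩
  · rw [hb k i hi ha]; ring
  · have := h.ratio_succ ha₀ k
    simp only [hr]
    rw [this, hi₀]
    ring
  · have h1 : dualMass lam a b l k = r k * mass lam a l k +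
        factor l θ N k ^ 2 * ∑ i with lam i = l, δ i * a 0 i ^ 2 := by
      rw [dualMass, mass, Finset.mul_sum, Finset.mul_sum, ← Finset.sum_add_distrib]
      refine Finset.sum_congr rfl fun i hi => ?_
      have hi' := (Finset.mem_filter.1 hi).2
      by_cases ha : a 0 i = 0
      · simp [h.a_eq_factor k i, ha]
      · rw [hb k i hi' ha, h.a_eq_factor k i, hi']; ring
    rw [h1, h.mass_eq l k, hg]
    field_simp
  · exact (abs_add_le _ _).trans (by have := hB₀ k; simp only [hr]; linarith)

end DiagRQI

/-! ### The two limiting regimes: `τ = 0` and `τ > 0` -/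

namespace DiagRQI

variable {ι : Type*} [Fintype ι] {lam mu : ι → ℝ} {a b : ℕ → ι → ℝ} {θ η N M : ℕ → ℝ} {C : ℝ}

theorem tendsto_mul_b_zero (h : DiagRQI lam mu a b θ η N M C) {x : ℕ → ℝ} (i : ι)
    (hx : Tendsto x atTop (𝓝 0)) : Tendsto (fun k => x k * b k i) atTop (𝓝 0) := by
  have := bdd_le_mul_tendsto_zero
      (Eventually.of_forall fun k => (abs_le.1 (h.bdd k i)).1)
      (Eventually.of_forall fun k => (abs_le.1 (h.bdd k i)).2) hx
  exact this.congr fun k => mul_comm _ _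

/-- Vanishing residuals: up to a common sign the iterates converge to an eigenvector. -/
theorem converges_of_tau_eq_zero (h : DiagRQI lam mu a b θ η N M C) {t : ℝ}
    (hτ : Tendsto (fun k => (N k)⁻¹) atTop (𝓝 0)) (ht : Tendsto θ atTop (𝓝 t))
    (hdef : ∀ i, Tendsto (fun k => (lam i - θ k) * a k i - (N k)⁻¹ * a (k + 1) i) atTop (𝓝 0)) :
    ∃ (nu : ℝ) (x y : ι → ℝ) (s : ℕ → ℝ), (∀ k, s k = 1 ∨ s k = -1) ∧
      Tendsto η atTop (𝓝 nu) ∧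
      (∀ i, Tendsto (fun k => s k * a k i) atTop (𝓝 (x i))) ∧
      (∀ i, Tendsto (fun k => s k * b k i) atTop (𝓝 (y i))) ∧
      (∀ i, (lam i - t) * x i = 0) ∧
      (∀ i, (lam i - t) * y i + (mu i - nu) * x i = 0) := by
  classical
  have ha0 : ∀ i, lam i ≠ t → Tendsto (fun k => a k i) atTop (𝓝 0) := fun i hi =>
    h.tendsto_a_zero hτ ht hdef (by
      simpa using sub_ne_zero.2 hi)
  have hmass : Tendsto (mass lam a t) atTop (𝓝 1) := by
    have h1 : Tendsto (fun k => 1 - ∑ i with ¬ lam i = t, a k i ^ 2) atTop (𝓝 (1 - 0)) := by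
      refine tendsto_const_nhds.sub ?_
      rw [← Finset.sum_const_zero (s := Finset.univ.filter fun i => ¬ lam i = t)]
      refine tendsto_finsetSum _ fun i hi => ?_
      simpa using (ha0 i (Finset.mem_filter.1 hi).2).pow 2
    rw [sub_zero] at h1
    refine h1.congr fun k => ?_
    rw [← h.unit k, ← Finset.sum_filter_add_sum_filter_not Finset.univ (fun i => lam i = t), mass]
    ring
  have hdm : Tendsto (dualMass lam a b t) atTop (𝓝 0) := by
    have h1 : Tendsto (fun k => - ∑ i with ¬ lam i = t, a k i * b k i) atTop (𝓝 (-0)) := by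
      refine Tendsto.neg ?_
      rw [← Finset.sum_const_zero (s := Finset.univ.filter fun i => ¬ lam i = t)]
      exact tendsto_finsetSum _ fun i hi =>
        h.tendsto_mul_b_zero i (ha0 i (Finset.mem_filter.1 hi).2)
    rw [neg_zero] at h1
    refine h1.congr fun k => ?_
    have := h.orth k
    rw [← Finset.sum_filter_add_sum_filter_not Finset.univ (fun i => lam i = t)] at this
    rw [dualMass]
    linarith
  obtain ⟨p, nu, β, γ, B, hp, hfac, -, hmu, hb, hβ, hβm, hβB⟩ :=
    h.exists_class_data one_pos hmass ht
  have hβ0 : Tendsto β atTop (𝓝 0) := by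
    have h1 := hdm.div hmass one_ne_zero
    rw [zero_div] at h1
    refine h1.congr' ?_
    filter_upwards [hmass.eventually_ne one_ne_zero] with k hk
    change dualMass lam a b t k / mass lam a t k = β k
    rw [← hβm k, mul_div_cancel_right₀ _ hk]
  have hη : Tendsto η atTop (𝓝 nu) := by
    have h1 : Tendsto (fun k => nu +
        ∑ i, ((mu i - nu) * a k i ^ 2 + 2 * (lam i - t) * (a k i * b k i))) atTop
        (𝓝 (nu + ∑ _i : ι, 0)) := by
      refine tendsto_const_nhds.add (tendsto_finsetSum _ fun i _ => ?_)
      by_cases hi : lam i = t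
      · refine tendsto_const_nhds.congr fun k => ?_
        by_cases ha : a 0 i = 0
        · simp [h.a_eq_factor k i, ha]
        · simp [hmu i hi ha, hi]
      · have h2 := ((ha0 i hi).pow 2).const_mul (mu i - nu)
        have h3 := (h.tendsto_mul_b_zero i (ha0 i hi)).const_mul (2 * (lam i - t))
        simpa using h2.add h3
    simp only [Finset.sum_const_zero, add_zero] at h1
    refine h1.congr fun k => ?_
    rw [h.eta_eq k]
    have e1 : ∑ i, ((mu i - nu) * a k i ^ 2 + 2 * (lam i - t) * (a k i * b k i)) =
        ∑ i, (mu i * a k i ^ 2 + 2 * lam i * (a k i * b k i)) - nu * ∑ i, a k i ^ 2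
          - 2 * t * ∑ i, a k i * b k i := by
      rw [Finset.mul_sum, Finset.mul_sum, ← Finset.sum_sub_distrib, ← Finset.sum_sub_distrib]
      exact Finset.sum_congr rfl fun i _ => by ring
    rw [e1, h.unit, h.orth]
    ring
  -- the quotient of consecutive factors
  have hquot : Tendsto (fun k => |factor t θ N (k + 1)| / |factor t θ N k|) atTop (𝓝 1) := by
    have := ((tendsto_add_atTop_iff_nat 1).2 hfac).div hfac hp.ne'
    rwa [div_self hp.ne'] at this
  -- The recursion for `b` contains `M k / N k`, which is eliminated through the recursion for `β`.
  -- This introduces the singular quotient `a (k + 1) i / (t - θ k)`; it is harmless, being `a k i /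
  -- (lam i - θ k)` times a ratio of consecutive factors, which tends to one in absolute value.
  have hb0 : ∀ i, lam i ≠ t → Tendsto (fun k => b k i) atTop (𝓝 0) := by
    intro i hi
    rw [← tendsto_add_atTop_iff_nat 1]
    have hd : Tendsto (fun k => (lam i - θ k)⁻¹) atTop (𝓝 (lam i - t)⁻¹) :=
      (tendsto_const_nhds.sub ht).inv₀ (sub_ne_zero.2 hi)
    have ha1 := (tendsto_add_atTop_iff_nat 1).2 (ha0 i hi)
    have e1 : Tendsto (fun k => ((N k)⁻¹ * (lam i - θ k)⁻¹) * b k i) atTop (𝓝 0) :=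
      h.tendsto_mul_b_zero i (by simpa using hτ.mul hd)
    have e2 : Tendsto (fun k => (β k - β (k + 1)) * a (k + 1) i) atTop (𝓝 0) := by
      have := (hβ0.sub ((tendsto_add_atTop_iff_nat 1).2 hβ0)).mul ha1
      simpa using this
    have e3 : Tendsto (fun k => a (k + 1) i / (t - θ k)) atTop (𝓝 0) := by
      have h1 : Tendsto (fun k => |a k i| * (|factor t θ N (k + 1)| / |factor t θ N k|)
          * |(lam i - θ k)⁻¹|) atTop (𝓝 0) := by
        have := ((ha0 i hi).abs.mul hquot).mul hd.abs
        simpa using this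
      rw [tendsto_zero_iff_abs_tendsto_zero]
      refine h1.congr' ?_
      filter_upwards [hfac.eventually_ne hp.ne'] with k hk
      have hf : factor t θ N (k + 1) = factor t θ N k * (N k * (t - θ k))⁻¹ := by
        rw [factor, Finset.prod_range_succ, ← factor]
      have hN := (h.pos k).ne'
      have hdi := h.ne k i
      simp only [Function.comp]
      rw [hf, ← h.step_a k i, ← abs_div, ← abs_mul, ← abs_mul]
      congr 1
      have hfk : factor t θ N k ≠ 0 := fun h0 => hk (by rw [h0, abs_zero])
      rw [mul_div_cancel_left₀ _ hfk, mul_inv]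
      field_simp
    have e4 : Tendsto (fun k => (nu - η k) * (a (k + 1) i / (t - θ k))) atTop (𝓝 0) := by
      simpa using (tendsto_const_nhds.sub hη).mul e3
    have e5 : Tendsto (fun k => (mu i - η k) * (lam i - θ k)⁻¹ * a (k + 1) i) atTop (𝓝 0) := by
      simpa using ((tendsto_const_nhds.sub hη).mul hd).mul ha1
    have := ((e1.sub e2).add e4).sub e5
    simp only [sub_zero, add_zero] at this
    refine this.congr fun k => ?_
    have hN := (h.pos k).ne'
    have hdi := h.ne k i
    have hM : M k / N k = β k - β (k + 1) - (nu - η k) / (t - θ k) := by rw [hβ k]; ring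
    have hb1 : b (k + 1) i = (N k)⁻¹ * (lam i - θ k)⁻¹ * b k i - M k / N k * a (k + 1) i
        - (mu i - η k) * (lam i - θ k)⁻¹ * a (k + 1) i := by
      rw [← h.step_b k i]
      field_simp
      ring
    rw [hb1, hM]
    ring
  -- All coordinates in the limiting eigenspace share one real factor, so its sign is the only thing
  -- that can oscillate.
  set s : ℕ → ℝ := fun k => if factor t θ N k < 0 then -1 else 1 with hs
  have hs1 : ∀ k, s k = 1 ∨ s k = -1 := fun k => by
    simp only [hs]; split_ifs <;> simp
  have hsf : ∀ k, s k * factor t θ N k = |factor t θ N k| := fun k => by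
    simp only [hs]
    split_ifs with h0
    · rw [abs_of_neg h0]; ring
    · rw [abs_of_nonneg (not_lt.1 h0), one_mul]
  have hs0 : ∀ {x : ℕ → ℝ}, Tendsto x atTop (𝓝 0) →
      Tendsto (fun k => s k * x k) atTop (𝓝 0) := fun {x} hx =>
    bdd_le_mul_tendsto_zero (b := -1) (B := 1)
      (Eventually.of_forall fun k => by rcases hs1 k with h | h <;> norm_num [h])
      (Eventually.of_forall fun k => by rcases hs1 k with h | h <;> norm_num [h]) hx
  have hxa : ∀ i, lam i = t → Tendsto (fun k => s k * a k i) atTop (𝓝 (p * a 0 i)) := by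
    intro i hi
    refine (hfac.mul_const (a 0 i)).congr fun k => ?_
    rw [h.a_eq_factor k i, hi, ← hsf k]
    ring
  refine ⟨nu, fun i => if lam i = t then p * a 0 i else 0,
    fun i => if lam i = t then (if a 0 i = 0 then p * b 0 i else γ i * (p * a 0 i)) else 0,
    s, hs1, hη, fun i => ?_, fun i => ?_, fun i => ?_, fun i => ?_⟩
  · by_cases hi : lam i = t
    · simpa only [hi, if_true] using hxa i hi
    · simpa only [hi, if_false] using hs0 (ha0 i hi)
  · by_cases hi : lam i = t
    · by_cases ha : a 0 i = 0
      · simp only [hi, ha, if_true]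
        refine (hfac.mul_const (b 0 i)).congr fun k => ?_
        rw [h.b_of_a_eq_zero ha k, hi, ← hsf k]
        ring
      · simp only [hi, ha, if_true, if_false]
        have h1 := (hβ0.add_const (γ i)).mul (hxa i hi)
        rw [zero_add] at h1
        refine h1.congr fun k => ?_
        rw [hb k i hi ha]
        ring
    · simpa only [hi, if_false] using hs0 (hb0 i hi)
  · by_cases hi : lam i = t <;> simp [hi]
  · by_cases hi : lam i = t
    · by_cases ha : a 0 i = 0
      · simp [hi, ha]
      · simp [hi, hmu i hi ha]
    · simp [hi]

/-- Residuals bounded away from zero: the Rayleigh quotients converge to the midpoint of two dual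
eigenvalues. -/
theorem midpoint_of_tau_pos (h : DiagRQI lam mu a b θ η N M C) {τ t : ℝ} (hpos : 0 < τ)
    (hτ : Tendsto (fun k => (N k)⁻¹) atTop (𝓝 τ)) (ht : Tendsto θ atTop (𝓝 t))
    (hdef : ∀ i, Tendsto (fun k => (lam i - θ k) * a k i - (N k)⁻¹ * a (k + 1) i) atTop (𝓝 0)) :
    ∃ i j, lam i = t + τ ∧ lam j = t - τ ∧ Tendsto η atTop (𝓝 ((mu i + mu j) / 2)) := by
  classical
  have hpm : t + τ ≠ t - τ := by intro h0; linarith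
  have ha0 : ∀ i, lam i ≠ t + τ → lam i ≠ t - τ → Tendsto (fun k => a k i) atTop (𝓝 0) := by
    intro i h1 h2
    refine h.tendsto_a_zero hτ ht hdef fun h3 => ?_
    rcases sq_eq_sq_iff_eq_or_eq_neg.1 h3 with h4 | h4
    · exact h1 (by linarith)
    · exact h2 (by linarith)
  have hsplit : ∀ f : ι → ℝ, ∑ i, f i = ∑ i with lam i = t + τ, f i + ∑ i with lam i = t - τ, f i
      + ∑ i with ¬ (lam i = t + τ ∨ lam i = t - τ), f i := by
    intro f
    rw [← Finset.sum_filter_add_sum_filter_not Finset.univ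
      (fun i => lam i = t + τ ∨ lam i = t - τ), Finset.filter_or, Finset.sum_union]
    rw [Finset.disjoint_filter]
    intro i _ h1 h2
    exact hpm (h1.symm.trans h2)
  have hrest : ∀ f : ℕ → ι → ℝ, (∀ i, Tendsto (fun k => a k i) atTop (𝓝 0) →
      Tendsto (fun k => f k i) atTop (𝓝 0)) →
      Tendsto (fun k => ∑ i with ¬ (lam i = t + τ ∨ lam i = t - τ), f k i) atTop (𝓝 0) := by
    intro f hf
    rw [← Finset.sum_const_zero
      (s := Finset.univ.filter fun i => ¬ (lam i = t + τ ∨ lam i = t - τ))]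
    refine tendsto_finsetSum _ fun i hi => hf i ?_
    have := not_or.1 (Finset.mem_filter.1 hi).2
    exact ha0 i this.1 this.2
  have hsum : Tendsto (fun k => mass lam a (t + τ) k + mass lam a (t - τ) k) atTop (𝓝 1) := by
    have h1 := (hrest (fun k i => a k i ^ 2) fun i hi => by simpa using hi.pow 2).const_sub 1
    rw [sub_zero] at h1
    refine h1.congr fun k => ?_
    rw [← h.unit k, hsplit, mass, mass]
    ring
  -- Up to vanishing terms `θ k - t` is `τ` times the difference of the two masses, and it tends to
  -- zero.
  have hdiff : Tendsto (fun k => mass lam a (t + τ) k - mass lam a (t - τ) k) atTop (𝓝 0) := by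
    have h1 := hrest (fun k i => (lam i - t) * a k i ^ 2)
      fun i hi => by simpa using (hi.pow 2).const_mul (lam i - t)
    have h2 := (((ht.sub_const t).sub h1).div_const τ)
    simp only [sub_self, zero_div] at h2
    refine h2.congr fun k => ?_
    have h3 : θ k - t = ∑ i, (lam i - t) * a k i ^ 2 := by
      have e1 : ∑ i, (lam i - t) * a k i ^ 2 =
          ∑ i, lam i * a k i ^ 2 - t * ∑ i, a k i ^ 2 := by
        rw [Finset.mul_sum, ← Finset.sum_sub_distrib]
        exact Finset.sum_congr rfl fun i _ => by ring
      rw [e1, h.unit, h.theta_eq k, mul_one]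
    have h4 : ∑ i with lam i = t + τ, (lam i - t) * a k i ^ 2 = τ * mass lam a (t + τ) k := by
      rw [mass, Finset.mul_sum]
      exact Finset.sum_congr rfl fun i hi => by rw [(Finset.mem_filter.1 hi).2]; ring
    have h5 : ∑ i with lam i = t - τ, (lam i - t) * a k i ^ 2 = -τ * mass lam a (t - τ) k := by
      rw [mass, Finset.mul_sum]
      exact Finset.sum_congr rfl fun i hi => by rw [(Finset.mem_filter.1 hi).2]; ring
    rw [h3, hsplit, h4, h5]
    field_simp
    ring
  have hm1 : Tendsto (mass lam a (t + τ)) atTop (𝓝 (1 / 2)) := by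
    have := (hsum.add hdiff).div_const 2
    rw [add_zero] at this
    exact this.congr fun k => by ring
  have hm2 : Tendsto (mass lam a (t - τ)) atTop (𝓝 (1 / 2)) := by
    have := (hsum.sub hdiff).div_const 2
    rw [sub_zero] at this
    exact this.congr fun k => by ring
  obtain ⟨p, nu, β, γ, B, hp, hfac, ⟨i, hi, hmui, -⟩, hmu, hb, hβ, hβm, hβB⟩ :=
    h.exists_class_data (by norm_num) hm1 ht
  obtain ⟨p', nu', β', γ', B', hp', hfac', ⟨j, hj, hmuj, -⟩, hmu', hb', hβ', hβm', hβB'⟩ :=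
    h.exists_class_data (by norm_num) hm2 ht
  refine ⟨i, j, hi, hj, ?_⟩
  rw [hmui, hmuj]
  set m := (nu + nu') / 2 with hm
  -- Orthogonality allows `lam i` to be replaced by `lam i - t` in `η`. The two classes then
  -- contribute `± 2 * τ` times `β`, `β'` times masses tending to `1 / 2`.
  have hηΔ : Tendsto (fun k => η k - m - τ * (β k - β' k)) atTop (𝓝 0) := by
    have h1 := hrest (fun k i => mu i * a k i ^ 2 + 2 * (lam i - t) * (a k i * b k i)) fun i hi => by
      have h2 := (hi.pow 2).const_mul (mu i)
      have h3 := (h.tendsto_mul_b_zero i hi).const_mul (2 * (lam i - t))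
      simpa using h2.add h3
    have h2 : Tendsto (fun k => β k * (mass lam a (t + τ) k - 1 / 2)) atTop (𝓝 0) :=
      bdd_le_mul_tendsto_zero (Eventually.of_forall fun k => (abs_le.1 (hβB k)).1)
        (Eventually.of_forall fun k => (abs_le.1 (hβB k)).2) (by simpa using hm1.sub_const (1 / 2))
    have h3 : Tendsto (fun k => β' k * (mass lam a (t - τ) k - 1 / 2)) atTop (𝓝 0) :=
      bdd_le_mul_tendsto_zero (Eventually.of_forall fun k => (abs_le.1 (hβB' k)).1)
        (Eventually.of_forall fun k => (abs_le.1 (hβB' k)).2) (by simpa using hm2.sub_const (1 / 2))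
    have h4 : Tendsto (fun k => nu * mass lam a (t + τ) k + nu' * mass lam a (t - τ) k - m)
        atTop (𝓝 0) := by
      have := ((hm1.const_mul nu).add (hm2.const_mul nu')).sub_const m
      have e : nu * (1 / 2) + nu' * (1 / 2) - m = 0 := by rw [hm]; ring
      rwa [e] at this
    have h5 := (h1.add h4).add ((h2.sub h3).const_mul (2 * τ))
    simp only [add_zero, sub_zero, mul_zero] at h5
    refine h5.congr fun k => ?_
    have h6 : η k = ∑ i, (mu i * a k i ^ 2 + 2 * (lam i - t) * (a k i * b k i)) := by
      have e1 : ∑ i, (mu i * a k i ^ 2 + 2 * (lam i - t) * (a k i * b k i)) =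
          ∑ i, (mu i * a k i ^ 2 + 2 * lam i * (a k i * b k i))
          - 2 * t * ∑ i, a k i * b k i := by
        rw [Finset.mul_sum, ← Finset.sum_sub_distrib]
        exact Finset.sum_congr rfl fun i _ => by ring
      rw [e1, h.orth, h.eta_eq]
      ring
    have h7 : ∑ i with lam i = t + τ, (mu i * a k i ^ 2 + 2 * (lam i - t) * (a k i * b k i)) =
        nu * mass lam a (t + τ) k + 2 * τ * dualMass lam a b (t + τ) k := by
      rw [mass, dualMass, Finset.mul_sum, Finset.mul_sum, ← Finset.sum_add_distrib]
      refine Finset.sum_congr rfl fun i hi => ?_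
      have hi := (Finset.mem_filter.1 hi).2
      by_cases ha : a 0 i = 0
      · simp [h.a_eq_factor k i, ha]
      · rw [hmu i hi ha, hi]; ring
    have h8 : ∑ i with lam i = t - τ, (mu i * a k i ^ 2 + 2 * (lam i - t) * (a k i * b k i)) =
        nu' * mass lam a (t - τ) k - 2 * τ * dualMass lam a b (t - τ) k := by
      rw [mass, dualMass, Finset.mul_sum, Finset.mul_sum, ← Finset.sum_sub_distrib]
      refine Finset.sum_congr rfl fun i hi => ?_
      have hi := (Finset.mem_filter.1 hi).2
      by_cases ha : a 0 i = 0
      · simp [h.a_eq_factor k i, ha]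
      · rw [hmu' i hi ha, hi]; ring
    rw [h6, hsplit, h7, h8, ← hβm k, ← hβm' k]
    ring
  obtain ⟨Bη, hBη⟩ := h.exists_eta_bound
  -- Subtracting the two recursions, the increment of `β - β'` is asymptotically `2 * (η k - m) /
  -- τ`, that is, `2 * (β k - β' k)`; hence the factor three.
  have hΔ : Tendsto (fun k => β k - β' k) atTop (𝓝 0) := by
    refine tendsto_zero_of_tripling (B := B + B')
      (fun k => (abs_sub _ _).trans (add_le_add (hβB k) (hβB' k))) ?_
    have hinv : Tendsto (fun k => (t + τ - θ k)⁻¹) atTop (𝓝 τ⁻¹) := by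
      have := (ht.const_sub (t + τ)).inv₀ (by rw [add_sub_cancel_left]; exact hpos.ne')
      rwa [add_sub_cancel_left] at this
    have hinv' : Tendsto (fun k => (t - τ - θ k)⁻¹) atTop (𝓝 (-τ⁻¹)) := by
      have e : t - τ - t = -τ := by ring
      have := (ht.const_sub (t - τ)).inv₀ (by rw [e]; exact neg_ne_zero.2 hpos.ne')
      rwa [e, inv_neg] at this
    have hz : ∀ c d : ℝ, ∀ x : ℕ → ℝ, Tendsto x atTop (𝓝 d) →
        Tendsto (fun k => (c - η k) * (x k - d)) atTop (𝓝 0) := fun c d x hx =>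
      bdd_le_mul_tendsto_zero (b := -(|c| + Bη)) (B := |c| + Bη)
        (Eventually.of_forall fun k =>
          (abs_le.1 ((abs_sub c (η k)).trans (add_le_add_right (hBη k) _))).1)
        (Eventually.of_forall fun k =>
          (abs_le.1 ((abs_sub c (η k)).trans (add_le_add_right (hBη k) _))).2)
        (by simpa using hx.sub_const d)
    have h1 := ((hz nu' _ _ hinv').sub (hz nu _ _ hinv)).add (hηΔ.const_mul (2 * τ⁻¹))
    simp only [add_zero, sub_zero, mul_zero] at h1
    refine h1.congr fun k => ?_
    rw [hβ k, hβ' k, hm, div_eq_mul_inv _ (t + τ - θ k), div_eq_mul_inv _ (t - τ - θ k)]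
    field_simp
    ring
  have h1 := (hηΔ.add (hΔ.const_mul τ)).add_const m
  simp only [mul_zero, zero_add] at h1
  exact h1.congr fun k => by ring

end DiagRQI

/-! ### First-order perturbation theory for a dual symmetric operator -/

section DualSpectral

variable {V : Type*} [NormedAddCommGroup V] [InnerProductSpace ℝ V] [FiniteDimensional ℝ V]

/-- A symmetric operator `A₀` has an orthonormal eigenbasis in which the blocks of a second
symmetric operator `A₁` on the eigenspaces of `A₀` are diagonal. -/
theorem LinearMap.IsSymmetric.exists_block_eigenbasis {A₀ A₁ : V →ₗ[ℝ] V}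
    (h₀ : A₀.IsSymmetric) (h₁ : A₁.IsSymmetric) :
    ∃ (ι : Type) (_ : Fintype ι) (e : OrthonormalBasis ι ℝ V) (lam : ι → ℝ),
      (∀ i, A₀ (e i) = lam i • e i) ∧
      ∀ i j, lam i = lam j → i ≠ j → inner ℝ (e i) (A₁ (e j)) = 0 := by
  classical
  have hint := h₀.direct_sum_isInternal
  have horth := h₀.orthogonalFamily_eigenspaces'
  -- The compression of `A₁` to each eigenspace of `A₀` is symmetric; its eigenvectors diagonalize
  -- the block.
  have hcomp : ∀ l : Module.End.Eigenvalues A₀, ((Submodule.orthogonalProjectionOnto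
      (Module.End.eigenspace A₀ (l : ℝ))).toLinearMap ∘ₗ A₁ ∘ₗ
        (Module.End.eigenspace A₀ (l : ℝ)).subtype).IsSymmetric := by
    intro l x y
    simp only [LinearMap.comp_apply, ContinuousLinearMap.coe_coe, Submodule.subtype_apply]
    rw [Submodule.inner_orthogonalProjectionOnto_eq_of_mem_right,
      Submodule.inner_orthogonalProjectionOnto_eq_of_mem_left]
    exact h₁ x y
  let v := fun l => (hcomp l).eigenvectorBasis rfl
  let e := hint.collectedOrthonormalBasis horth v
  have he : ∀ i, e i = (v i.1 i.2 : V) := fun i => by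
    simp [e, DirectSum.IsInternal.collectedOrthonormalBasis]
  refine ⟨_, inferInstance, e, fun i => (i.1 : ℝ), fun i => ?_, ?_⟩
  · exact Module.End.mem_eigenspace_iff.1 (hint.collectedOrthonormalBasis_mem horth v i)
  · rintro ⟨l, i⟩ ⟨l', j⟩ hl hij
    obtain rfl : l = l' := Subtype.ext hl
    have hij' : i ≠ j := fun h => hij (by rw [h])
    rw [he, he]
    have h2 := (hcomp l).apply_eigenvectorBasis rfl j
    have h3 := congrArg (fun w => inner ℝ (v l i) w) h2
    simp only [LinearMap.comp_apply, ContinuousLinearMap.coe_coe, Submodule.subtype_apply] at h3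
    rw [Submodule.inner_orthogonalProjectionOnto_eq_of_mem_left, inner_smul_right] at h3
    rw [h3, (v l).inner_eq_zero hij', mul_zero]

/-- Dual orthonormal eigenbasis `e i + f i ε` of the dual symmetric operator `A₀ + A₁ ε`. -/
theorem LinearMap.IsSymmetric.exists_dual_eigenbasis {A₀ A₁ : V →ₗ[ℝ] V}
    (h₀ : A₀.IsSymmetric) (h₁ : A₁.IsSymmetric) :
    ∃ (ι : Type) (_ : Fintype ι) (e : OrthonormalBasis ι ℝ V) (f : ι → V) (lam mu : ι → ℝ),
      (∀ i, A₀ (e i) = lam i • e i) ∧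
      (∀ i, A₀ (f i) + A₁ (e i) = lam i • f i + mu i • e i) ∧
      ∀ i j, inner ℝ (f i) (e j) + inner ℝ (e i) (f j) = 0 := by
  classical
  obtain ⟨ι, hι, e, lam, h, hblock⟩ := h₀.exists_block_eigenbasis h₁
  -- The usual first-order correction of eigenvectors. For equal eigenvalues division by zero gives
  -- coefficient `0`, which is the wanted choice because the corresponding off-diagonal entries
  -- vanish.
  refine ⟨ι, hι, e, fun i => ∑ j, (inner ℝ (e j) (A₁ (e i)) / (lam i - lam j)) • e j, lam,
    fun i => inner ℝ (e i) (A₁ (e i)), h, fun i => ?_, fun i j => ?_⟩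
  · have h2 : A₁ (e i) = ∑ j, inner ℝ (e j) (A₁ (e i)) • e j := (e.sum_repr' _).symm
    have h3 : (inner ℝ (e i) (A₁ (e i)) : ℝ) • e i =
        ∑ j, (if j = i then inner ℝ (e j) (A₁ (e i)) else 0 : ℝ) • e j := by
      simp
    rw [h3, map_sum, Finset.smul_sum]
    nth_rewrite 2 [h2]
    rw [← Finset.sum_add_distrib, ← Finset.sum_add_distrib]
    refine Finset.sum_congr rfl fun j _ => ?_
    rw [map_smul, h j, smul_smul, smul_smul, ← add_smul, ← add_smul]
    congr 1
    by_cases hij : j = i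
    · simp [hij]
    · by_cases hl : lam j = lam i
      · simp [hij, hl, hblock j i hl hij]
      · have : lam i - lam j ≠ 0 := sub_ne_zero.2 (Ne.symm hl)
        rw [if_neg hij]
        field_simp
        ring
  · simp only [inner_sum, sum_inner, inner_smul_left, inner_smul_right, e.inner_eq_ite]
    have h2 : inner ℝ (e i) (A₁ (e j)) = inner ℝ (e j) (A₁ (e i)) := by
      rw [← h₁, real_inner_comm]
    by_cases hl : lam i = lam j
    · simp [hl]
    · have h3 : lam i - lam j ≠ 0 := sub_ne_zero.2 hl
      have h4 : lam j - lam i ≠ 0 := sub_ne_zero.2 (Ne.symm hl)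
      simp [h2]
      field_simp
      ring

end DualSpectral

/-! ### From dual symmetric operators to dual coordinates and back -/

/-- Rayleigh quotient iteration for the dual symmetric operator `A₀ + A₁ ε` on a real inner
product space, with iterates `u k + v k ε`, Rayleigh quotients `θ k + η k ε` and normalizing
factors `N k + M k ε`, all shifted operators being nonsingular. -/
structure DualRQI {V : Type*} [NormedAddCommGroup V] [InnerProductSpace ℝ V]
    (A₀ A₁ : V →ₗ[ℝ] V) (u v : ℕ → V) (θ η N M : ℕ → ℝ) (C : ℝ) : Prop where
  unit : ∀ k, ‖u k‖ = 1
  orth : ∀ k, inner ℝ (u k) (v k) = 0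
  theta_eq : ∀ k, θ k = inner ℝ (u k) (A₀ (u k))
  eta_eq : ∀ k, η k = 2 * inner ℝ (v k) (A₀ (u k)) + inner ℝ (u k) (A₁ (u k))
  pos : ∀ k, 0 < N k
  nonsing : ∀ k x, A₀ x = θ k • x → x = 0
  step_u : ∀ k, N k • (A₀ (u (k + 1)) - θ k • u (k + 1)) = u k
  step_v : ∀ k, N k • (A₀ (v (k + 1)) - θ k • v (k + 1)) +
    M k • (A₀ (u (k + 1)) - θ k • u (k + 1)) + N k • (A₁ (u (k + 1)) - η k • u (k + 1)) = v k
  bdd : ∀ k, ‖v k‖ ≤ C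

namespace DualRQI

variable {V : Type*} [NormedAddCommGroup V] [InnerProductSpace ℝ V] {A₀ A₁ : V →ₗ[ℝ] V}
  {u v : ℕ → V} {θ η N M : ℕ → ℝ} {C : ℝ} {ι : Type*} [Fintype ι]

/-- Orthonormality to first order says that the matrix of the `f i` in the basis `e` is skew, so
transposing it changes the sign. -/
theorem sum_skew (e : OrthonormalBasis ι ℝ V) (f : ι → V)
    (hf : ∀ i j, inner ℝ (f i) (e j) + inner ℝ (e i) (f j) = 0) (x : V) (j : ι) :
    ∑ i, inner ℝ (e i) x * inner ℝ (e j) (f i) = -inner ℝ (f j) x := by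
  have h1 : inner ℝ (f j) x = ∑ i, inner ℝ (e i) x * inner ℝ (f j) (e i) := by
    conv_lhs => rw [← e.sum_repr' x]
    simp only [inner_sum, inner_smul_right]
  rw [h1, ← Finset.sum_neg_distrib]
  refine Finset.sum_congr rfl fun i _ => ?_
  have := hf j i
  rw [eq_neg_of_add_eq_zero_right this]
  ring

/-- A dual vector is the combination of the dual basis vectors with its dual coordinates. -/
theorem dual_expansion (e : OrthonormalBasis ι ℝ V) (f : ι → V)
    (hf : ∀ i j, inner ℝ (f i) (e j) + inner ℝ (e i) (f j) = 0) (x y : V) :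
    y = ∑ i, ((inner ℝ (e i) y + inner ℝ (f i) x) • e i + inner ℝ (e i) x • f i) := by
  classical
  refine e.repr.injective (PiLp.ext fun j => ?_)
  simp only [e.repr_apply_apply, inner_sum, inner_add_right, inner_smul_right,
    Finset.sum_add_distrib, sum_skew e f hf x j]
  simp [e.inner_eq_ite]

/-- Passage to the coordinates of a dual eigenbasis. -/
theorem diag (h : DualRQI A₀ A₁ u v θ η N M C) (h₀ : A₀.IsSymmetric) (h₁ : A₁.IsSymmetric)
    (e : OrthonormalBasis ι ℝ V) (f : ι → V) {lam mu : ι → ℝ}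
    (he : ∀ i, A₀ (e i) = lam i • e i)
    (hfe : ∀ i, A₀ (f i) + A₁ (e i) = lam i • f i + mu i • e i)
    (hf : ∀ i j, inner ℝ (f i) (e j) + inner ℝ (e i) (f j) = 0) :
    DiagRQI lam mu (fun k i => inner ℝ (e i) (u k))
      (fun k i => inner ℝ (e i) (v k) + inner ℝ (f i) (u k)) θ η N M (C + ∑ i, ‖f i‖) := by
  have hA₀ : ∀ i x, inner ℝ (e i) (A₀ x) = lam i * inner ℝ (e i) x := fun i x => by
    rw [← h₀, he, inner_smul_left]; rfl
  have hA₁ : ∀ i x, inner ℝ (f i) (A₀ x) + inner ℝ (e i) (A₁ x) =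
      lam i * inner ℝ (f i) x + mu i * inner ℝ (e i) x := fun i x => by
    rw [← h₀, ← h₁, ← inner_add_left, hfe, inner_add_left, inner_smul_left, inner_smul_left]; rfl
  -- The quadratic form of a skew matrix vanishes: exchanging the summations shows that the sum is
  -- its own negative.
  have hcross : ∀ x, ∑ i, inner ℝ (e i) x * inner ℝ (f i) x = 0 := fun x => by
    have h1 : ∑ j, inner ℝ (e j) x * -inner ℝ (f j) x =
        ∑ i, inner ℝ (e i) x * inner ℝ (f i) x := by
      simp only [← sum_skew e f hf x, Finset.mul_sum]
      rw [Finset.sum_comm]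
      refine Finset.sum_congr rfl fun i _ => ?_
      have h2 : inner ℝ (f i) x = ∑ j, inner ℝ (e j) x * inner ℝ (f i) (e j) := by
        conv_lhs => rw [← e.sum_repr' x]
        simp only [inner_sum, inner_smul_right]
      rw [h2, Finset.mul_sum]
      refine Finset.sum_congr rfl fun j _ => ?_
      rw [real_inner_comm (f i) (e j)]
      ring
    simp only [mul_neg, Finset.sum_neg_distrib] at h1
    linarith
  refine ⟨fun k => ?_, fun k => ?_, fun k => ?_, fun k => ?_, h.pos, fun k i hi => ?_,
    fun k i => ?_, fun k i => ?_, fun k i => ?_⟩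
  · have := e.sum_sq_norm_inner_right (u k)
    rw [h.unit k] at this
    simpa using this
  · simp only [mul_add, Finset.sum_add_distrib, hcross, add_zero]
    rw [← h.orth k, ← e.sum_inner_mul_inner]
    exact Finset.sum_congr rfl fun i _ => by rw [real_inner_comm]
  · rw [h.theta_eq, ← e.sum_inner_mul_inner]
    refine Finset.sum_congr rfl fun i _ => ?_
    rw [hA₀, real_inner_comm]
    ring
  · have h1 : inner ℝ (v k) (A₀ (u k)) = ∑ i, lam i *
        (inner ℝ (e i) (u k) * inner ℝ (e i) (v k)) := by
      rw [← e.sum_inner_mul_inner]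
      refine Finset.sum_congr rfl fun i _ => ?_
      rw [hA₀, real_inner_comm (e i)]
      ring
    have h2 : inner ℝ (u k) (A₁ (u k)) = ∑ i, (inner ℝ (e i) (u k) *
        (lam i * inner ℝ (f i) (u k) + mu i * inner ℝ (e i) (u k) -
          inner ℝ (f i) (A₀ (u k)))) := by
      rw [← e.sum_inner_mul_inner]
      refine Finset.sum_congr rfl fun i _ => ?_
      rw [← hA₁, real_inner_comm (e i)]
      ring
    have h3 : ∑ i, inner ℝ (e i) (u k) * inner ℝ (f i) (A₀ (u k)) =
        -∑ i, lam i * (inner ℝ (e i) (u k) * inner ℝ (f i) (u k)) := by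
      have h4 : ∀ i, inner ℝ (f i) (A₀ (u k)) =
          -∑ j, inner ℝ (e j) (A₀ (u k)) * inner ℝ (e i) (f j) := fun i => by
        rw [sum_skew e f hf, neg_neg]
      simp only [h4, mul_neg, Finset.sum_neg_distrib, hA₀, Finset.mul_sum]
      rw [Finset.sum_comm]
      congr 1
      refine Finset.sum_congr rfl fun j _ => ?_
      have h2 : inner ℝ (f j) (u k) = ∑ i, inner ℝ (e i) (u k) * inner ℝ (f j) (e i) := by
        conv_lhs => rw [← e.sum_repr' (u k)]
        simp only [inner_sum, inner_smul_right]
      rw [h2, Finset.mul_sum, Finset.mul_sum]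
      refine Finset.sum_congr rfl fun i _ => ?_
      rw [real_inner_comm (f j) (e i)]
      ring
    rw [h.eta_eq, h1, h2]
    simp only [mul_sub, Finset.sum_sub_distrib, h3]
    rw [Finset.mul_sum, sub_neg_eq_add, ← Finset.sum_add_distrib, ← Finset.sum_add_distrib]
    exact Finset.sum_congr rfl fun i _ => by ring
  · have h1 : e i = 0 := h.nonsing k (e i) (by rw [he, sub_eq_zero.1 hi])
    have h2 := e.norm_eq_one i
    rw [h1, norm_zero] at h2
    exact zero_ne_one h2
  · rw [← h.step_u k]
    rw [inner_smul_right, inner_sub_right, inner_smul_right, hA₀]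
    ring
  · rw [← h.step_v k]
    rw [← h.step_u k]
    simp only [inner_add_right, inner_smul_right, inner_sub_right, hA₀]
    have := hA₁ i (u (k + 1))
    linear_combination (-N k) * this
  · refine (abs_add_le _ _).trans (add_le_add ?_ ?_)
    · have := abs_real_inner_le_norm (e i) (v k)
      rw [e.norm_eq_one, one_mul] at this
      exact this.trans (h.bdd k)
    · have := abs_real_inner_le_norm (f i) (u k)
      rw [h.unit, mul_one] at this
      exact this.trans (Finset.single_le_sum (f := fun i => ‖f i‖)
        (fun i _ => norm_nonneg _) (Finset.mem_univ i))

/-- Convergence of the Rayleigh quotient iteration for dual symmetric operators. -/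
theorem dichotomy [FiniteDimensional ℝ V] (h : DualRQI A₀ A₁ u v θ η N M C)
    (h₀ : A₀.IsSymmetric) (h₁ : A₁.IsSymmetric) :
    (∃ (t nu : ℝ) (x y : V) (s : ℕ → ℝ), (∀ k, s k = 1 ∨ s k = -1) ∧
      Tendsto θ atTop (𝓝 t) ∧ Tendsto η atTop (𝓝 nu) ∧
      Tendsto (fun k => s k • u k) atTop (𝓝 x) ∧ Tendsto (fun k => s k • v k) atTop (𝓝 y) ∧
      A₀ x = t • x ∧ A₀ y + A₁ x = t • y + nu • x) ∨
    (∃ (t τ nu₁ nu₂ : ℝ) (x₁ y₁ x₂ y₂ : V), 0 < τ ∧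
      Tendsto θ atTop (𝓝 t) ∧ Tendsto η atTop (𝓝 ((nu₁ + nu₂) / 2)) ∧
      x₁ ≠ 0 ∧ A₀ x₁ = (t + τ) • x₁ ∧ A₀ y₁ + A₁ x₁ = (t + τ) • y₁ + nu₁ • x₁ ∧
      x₂ ≠ 0 ∧ A₀ x₂ = (t - τ) • x₂ ∧ A₀ y₂ + A₁ x₂ = (t - τ) • y₂ + nu₂ • x₂ ∧
      Tendsto (fun k => (N k)⁻¹) atTop (𝓝 τ) ∧
      Tendsto (fun k => A₀ (u k) - θ k • u k - (N k)⁻¹ • u (k + 1)) atTop (𝓝 0)) := by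
  obtain ⟨ι, _, e, f, lam, mu, he, hfe, hf⟩ := h₀.exists_dual_eigenbasis h₁
  have hd := h.diag h₀ h₁ e f he hfe hf
  obtain ⟨τ, hτ0, hτ, hstep, hdef⟩ := hd.exists_tau
  obtain ⟨t, ht⟩ := hd.exists_theta_limit hτ hstep hdef
  rcases hτ0.eq_or_lt with rfl | hpos
  · left
    obtain ⟨nu, x, y, s, hs, hη, hx, hy, hex, hey⟩ := hd.converges_of_tau_eq_zero hτ ht hdef
    refine ⟨t, nu, ∑ i, x i • e i, ∑ i, (y i • e i + x i • f i), s, hs, ht, hη, ?_, ?_, ?_, ?_⟩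
    · refine (tendsto_finsetSum Finset.univ fun i _ => (hx i).smul_const (e i)).congr fun k => ?_
      conv_rhs => rw [← e.sum_repr' (u k), Finset.smul_sum]
      simp only [smul_smul]
    · refine (tendsto_finsetSum Finset.univ fun i _ => ((hy i).smul_const (e i)).add
        ((hx i).smul_const (f i))).congr fun k => ?_
      conv_rhs => rw [dual_expansion e f hf (u k) (v k), Finset.smul_sum]
      simp only [smul_smul, smul_add]
    · rw [map_sum, Finset.smul_sum]
      refine Finset.sum_congr rfl fun i _ => ?_
      rw [map_smul, he, smul_smul, smul_smul]
      congr 1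
      linarith [hex i]
    · rw [map_sum, map_sum, Finset.smul_sum, Finset.smul_sum, ← Finset.sum_add_distrib,
        ← Finset.sum_add_distrib]
      refine Finset.sum_congr rfl fun i _ => ?_
      have e1 : A₁ (e i) = lam i • f i + mu i • e i - A₀ (f i) := by rw [← hfe]; abel
      rw [map_add, map_smul, map_smul, map_smul, he, e1]
      have e2 := congrArg (fun c : ℝ => c • f i) (hex i)
      have e3 := congrArg (fun c : ℝ => c • e i) (hey i)
      simp only [zero_smul] at e2 e3
      linear_combination (norm := module) e2 + e3
  · right
    obtain ⟨i, j, hi, hj, hη⟩ := hd.midpoint_of_tau_pos hpos hτ ht hdef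
    have hne : ∀ i, e i ≠ 0 := fun i h0 => by
      have := e.norm_eq_one i
      rw [h0, norm_zero] at this
      exact zero_ne_one this
    refine ⟨t, τ, mu i, mu j, e i, f i, e j, f j, hpos, ht, hη, hne i, hi ▸ he i, hi ▸ hfe i,
      hne j, hj ▸ he j, hj ▸ hfe j, hτ, ?_⟩
    have h1 := tendsto_finsetSum Finset.univ fun i _ => (hdef i).smul_const (e i)
    simp only [zero_smul, Finset.sum_const_zero] at h1
    refine h1.congr fun k => ?_
    conv_rhs => rw [← e.sum_repr' (A₀ (u k) - θ k • u k - (N k)⁻¹ • u (k + 1))]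
    refine Finset.sum_congr rfl fun i _ => ?_
    rw [inner_sub_right, inner_sub_right, inner_smul_right, inner_smul_right, ← h₀, he,
      inner_smul_left]
    congr 1
    simp only [conj_trivial]
    ring

end DualRQI

/-! ### Dual quaternion vectors and matrices as pairs over a real Euclidean space -/

namespace DQ

/-- Quaternion vectors with the Euclidean norm, as a real inner product space. -/
abbrev QVec (n : ℕ) : Type := PiLp 2 fun _ : Fin n => ℍ[ℝ]

/-- Standard part of a dual quaternion vector. -/
def stdPart {n : ℕ} (x : Fin n → DQ) : QVec n := WithLp.toLp 2 fun i => (x i).fst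

/-- Dual part of a dual quaternion vector. -/
def dualPart {n : ℕ} (x : Fin n → DQ) : QVec n := WithLp.toLp 2 fun i => (x i).snd

@[simp] theorem stdPart_apply {n : ℕ} (x : Fin n → DQ) (i : Fin n) : stdPart x i = (x i).fst := rfl

@[simp] theorem dualPart_apply {n : ℕ} (x : Fin n → DQ) (i : Fin n) :
    dualPart x i = (x i).snd := rfl

/-- The dual quaternion vector with given standard and dual parts. -/
noncomputable def ofParts {n : ℕ} (x y : QVec n) : Fin n → DQ :=
  fun i => TrivSqZeroExt.inl (x i) + TrivSqZeroExt.inr (y i)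

@[simp] theorem stdPart_ofParts {n : ℕ} (x y : QVec n) : stdPart (ofParts x y) = x := by
  ext i : 1; simp [ofParts]

@[simp] theorem dualPart_ofParts {n : ℕ} (x y : QVec n) : dualPart (ofParts x y) = y := by
  ext i : 1; simp [ofParts]

theorem ext_parts {n : ℕ} {x y : Fin n → DQ} (h₁ : stdPart x = stdPart y)
    (h₂ : dualPart x = dualPart y) : x = y := by
  funext i
  exact TrivSqZeroExt.ext (congrArg (fun v : QVec n => v i) h₁)
    (congrArg (fun v : QVec n => v i) h₂)

/-- A quaternion matrix as a real linear operator. -/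
noncomputable def matOp {n : ℕ} (B : Matrix (Fin n) (Fin n) ℍ[ℝ]) : QVec n →ₗ[ℝ] QVec n where
  toFun x := WithLp.toLp 2 (B *ᵥ WithLp.ofLp x)
  map_add' x y := by simp [Matrix.mulVec_add]
  map_smul' c x := by simp [Matrix.mulVec_smul]

theorem matOp_apply {n : ℕ} (B : Matrix (Fin n) (Fin n) ℍ[ℝ]) (x : QVec n) (i : Fin n) :
    matOp B x i = ∑ j, B i j * x j := rfl

theorem re_mul_comm (a b : ℍ[ℝ]) : (a * b).re = (b * a).re := by
  simp only [Quaternion.re_mul]; ring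

theorem re_sum {ι : Type*} (s : Finset ι) (f : ι → ℍ[ℝ]) :
    (∑ i ∈ s, f i).re = ∑ i ∈ s, (f i).re :=
  map_sum (AddMonoidHom.mk' (fun q : ℍ[ℝ] => q.re) Quaternion.re_add) f s

theorem inner_eq_re_star_mul (a b : ℍ[ℝ]) : inner ℝ a b = (star a * b).re := by
  rw [real_inner_comm, Quaternion.inner_def, re_mul_comm]

theorem matOp_isSymmetric {n : ℕ} {B : Matrix (Fin n) (Fin n) ℍ[ℝ]}
    (hB : ∀ i j, star (B j i) = B i j) : (matOp B).IsSymmetric := by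
  intro x y
  simp only [PiLp.inner_apply, matOp_apply, sum_inner, inner_sum]
  rw [Finset.sum_comm]
  refine Finset.sum_congr rfl fun j _ => Finset.sum_congr rfl fun i _ => ?_
  rw [inner_eq_re_star_mul, inner_eq_re_star_mul, star_mul, hB, mul_assoc]

/-- Standard part of a dual quaternion matrix, as an operator. -/
noncomputable def stdOp {n : ℕ} (A : Matrix (Fin n) (Fin n) DQ) : QVec n →ₗ[ℝ] QVec n :=
  matOp (A.map TrivSqZeroExt.fst)

/-- Dual part of a dual quaternion matrix, as an operator. -/
noncomputable def dualOp {n : ℕ} (A : Matrix (Fin n) (Fin n) DQ) : QVec n →ₗ[ℝ] QVec n :=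
  matOp (A.map TrivSqZeroExt.snd)

@[simp] theorem fst_star (q : DQ) : (star q).fst = star q.fst := by
  change (TrivSqZeroExt.inl (star q.fst) + TrivSqZeroExt.inr (star q.snd) : DQ).fst = _
  simp

@[simp] theorem snd_star (q : DQ) : (star q).snd = star q.snd := by
  change (TrivSqZeroExt.inl (star q.fst) + TrivSqZeroExt.inr (star q.snd) : DQ).snd = _
  simp

@[simp] theorem fst_ofDual (a : DualNumber ℝ) : (ofDual a).fst = (a.fst : ℍ[ℝ]) := by
  simp [ofDual]

@[simp] theorem snd_ofDual (a : DualNumber ℝ) : (ofDual a).snd = (a.snd : ℍ[ℝ]) := by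
  simp [ofDual]

theorem stdOp_isSymmetric {n : ℕ} {A : Matrix (Fin n) (Fin n) DQ} (hA : A.IsHermitian) :
    (stdOp A).IsSymmetric :=
  matOp_isSymmetric fun i j => by
    simp only [Matrix.map_apply, ← fst_star]
    exact congrArg TrivSqZeroExt.fst (hA.apply i j)

theorem dualOp_isSymmetric {n : ℕ} {A : Matrix (Fin n) (Fin n) DQ} (hA : A.IsHermitian) :
    (dualOp A).IsSymmetric :=
  matOp_isSymmetric fun i j => by
    simp only [Matrix.map_apply, ← snd_star]
    exact congrArg TrivSqZeroExt.snd (hA.apply i j)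

theorem stdPart_mulVec {n : ℕ} (A : Matrix (Fin n) (Fin n) DQ) (x : Fin n → DQ) :
    stdPart (A *ᵥ x) = stdOp A (stdPart x) := by
  ext i : 1
  simp [stdOp, matOp_apply, Matrix.mulVec, dotProduct, TrivSqZeroExt.fst_sum]

theorem dualPart_mulVec {n : ℕ} (A : Matrix (Fin n) (Fin n) DQ) (x : Fin n → DQ) :
    dualPart (A *ᵥ x) = stdOp A (dualPart x) + dualOp A (stdPart x) := by
  ext i : 1
  simp [stdOp, dualOp, matOp_apply, Matrix.mulVec, dotProduct, TrivSqZeroExt.snd_sum,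
    Finset.sum_add_distrib]

theorem stdPart_mul_ofDual {n : ℕ} (x : Fin n → DQ) (a : DualNumber ℝ) :
    stdPart (fun i => x i * ofDual a) = a.fst • stdPart x := by
  ext i : 1
  simp [Quaternion.mul_coe_eq_smul]

theorem dualPart_mul_ofDual {n : ℕ} (x : Fin n → DQ) (a : DualNumber ℝ) :
    dualPart (fun i => x i * ofDual a) = a.fst • dualPart x + a.snd • stdPart x := by
  ext i : 1
  simp [Quaternion.mul_coe_eq_smul, add_comm]

theorem shifted_mulVec {n : ℕ} (A : Matrix (Fin n) (Fin n) DQ) (a : DualNumber ℝ)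
    (x : Fin n → DQ) : shifted A a *ᵥ x = A *ᵥ x - fun i => x i * ofDual a := by
  funext i
  have : ofDual a * x i = x i * ofDual a := by
    refine TrivSqZeroExt.ext ?_ ?_ <;>
      simp [Quaternion.mul_coe_eq_smul, Quaternion.coe_mul_eq_smul, add_comm]
  simp [shifted, Matrix.sub_mulVec, this]

theorem stdPart_sub {n : ℕ} (x y : Fin n → DQ) : stdPart (x - y) = stdPart x - stdPart y := by
  ext i : 1; simp

theorem dualPart_sub {n : ℕ} (x y : Fin n → DQ) : dualPart (x - y) = dualPart x - dualPart y := by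
  ext i : 1; simp

theorem appreciable_iff {n : ℕ} {x : Fin n → DQ} : Appreciable x ↔ stdPart x ≠ 0 := by
  constructor
  · rintro ⟨i, hi⟩ h
    exact hi (congrArg (fun v : QVec n => v i) h)
  · intro h
    by_contra hx
    refine h ?_
    ext i : 1
    by_contra hi
    exact hx ⟨i, hi⟩

theorem isEigenpair_iff {n : ℕ} {A : Matrix (Fin n) (Fin n) DQ} {a : DualNumber ℝ}
    {x : Fin n → DQ} : IsEigenpair A a x ↔ stdPart x ≠ 0 ∧
      stdOp A (stdPart x) = a.fst • stdPart x ∧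
      stdOp A (dualPart x) + dualOp A (stdPart x) = a.fst • dualPart x + a.snd • stdPart x := by
  rw [IsEigenpair, appreciable_iff, ← stdPart_mulVec, ← dualPart_mulVec, ← stdPart_mul_ofDual,
    ← dualPart_mul_ofDual]
  refine and_congr_right fun _ => ⟨fun h => by rw [h]; exact ⟨rfl, rfl⟩, fun h => ?_⟩
  exact ext_parts h.1 h.2

theorem fst_magnitude_sq (q : DQ) : (magnitude q ^ 2).fst = ‖q.fst‖ ^ 2 := by
  unfold magnitude
  split_ifs with h
  · simp
  · simp [not_not.1 h]

/-- Squaring removes the case distinction: when the standard part is zero both sides vanish. -/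
theorem snd_magnitude_sq (q : DQ) : (magnitude q ^ 2).snd = 2 * inner ℝ q.fst q.snd := by
  have h1 : (q.fst * star q.snd + q.snd * star q.fst).re = 2 * inner ℝ q.fst q.snd := by
    rw [Quaternion.re_add, ← Quaternion.inner_def, ← Quaternion.inner_def,
      real_inner_comm q.snd q.fst]
    ring
  unfold magnitude
  split_ifs with h
  · have : ‖q.fst‖ ≠ 0 := norm_ne_zero_iff.2 h
    rw [h1, sq, TrivSqZeroExt.snd_mul]
    simp
    field_simp
    ring
  · simp [not_not.1 h, sq]

theorem fst_norm2 {n : ℕ} {x : Fin n → DQ} (hx : Appreciable x) :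
    (norm2 x).fst = ‖stdPart x‖ := by
  rw [norm2, if_pos hx, dualSqrt, PiLp.norm_eq_of_L2]
  simp only [TrivSqZeroExt.fst_add, TrivSqZeroExt.fst_inl, TrivSqZeroExt.fst_inr, add_zero,
    TrivSqZeroExt.fst_sum, fst_magnitude_sq, stdPart_apply]

theorem snd_norm2 {n : ℕ} {x : Fin n → DQ} (hx : Appreciable x) :
    (norm2 x).snd = inner ℝ (stdPart x) (dualPart x) / ‖stdPart x‖ := by
  rw [norm2, if_pos hx, dualSqrt, PiLp.norm_eq_of_L2, PiLp.inner_apply]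
  simp only [TrivSqZeroExt.snd_add, TrivSqZeroExt.snd_inl, TrivSqZeroExt.snd_inr, zero_add,
    TrivSqZeroExt.fst_sum, TrivSqZeroExt.snd_sum, fst_magnitude_sq, snd_magnitude_sq,
    stdPart_apply, dualPart_apply]
  rw [← Finset.mul_sum, mul_div_mul_left _ _ two_ne_zero]

theorem norm2_eq_one_iff {n : ℕ} {x : Fin n → DQ} :
    norm2 x = 1 ↔ ‖stdPart x‖ = 1 ∧ inner ℝ (stdPart x) (dualPart x) = 0 := by
  constructor
  · intro h
    have hx : Appreciable x := by
      by_contra hx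
      rw [norm2, if_neg hx] at h
      have := congrArg TrivSqZeroExt.fst h
      simp at this
    have h1 := congrArg TrivSqZeroExt.fst h
    have h2 := congrArg TrivSqZeroExt.snd h
    rw [fst_norm2 hx, TrivSqZeroExt.fst_one] at h1
    rw [snd_norm2 hx, h1, div_one, TrivSqZeroExt.snd_one] at h2
    exact ⟨h1, h2⟩
  · rintro ⟨h1, h2⟩
    have hx : Appreciable x := appreciable_iff.2 fun h0 => by simp [h0] at h1
    refine TrivSqZeroExt.ext ?_ ?_
    · rw [fst_norm2 hx, h1, TrivSqZeroExt.fst_one]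
    · rw [snd_norm2 hx, h1, h2, zero_div, TrivSqZeroExt.snd_one]

theorem norm_dualPart_le {n : ℕ} (x : Fin n → DQ) : ‖dualPart x‖ ≤ norm2R x := by
  rw [PiLp.norm_eq_of_L2, norm2R]
  refine Real.sqrt_le_sqrt ?_
  have : 0 ≤ ∑ i, ‖(x i).fst‖ ^ 2 := Finset.sum_nonneg fun i _ => by positivity
  simpa using this

theorem fst_rayleigh {n : ℕ} {A : Matrix (Fin n) (Fin n) DQ} {a : DualNumber ℝ} {x : Fin n → DQ}
    (h : ofDual a = star x ⬝ᵥ (A *ᵥ x)) : a.fst = inner ℝ (stdPart x) (stdOp A (stdPart x)) := by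
  have h1 := congrArg (fun q : DQ => q.fst.re) h
  simp only [fst_ofDual, Quaternion.re_coe] at h1
  rw [h1, ← stdPart_mulVec, PiLp.inner_apply]
  simp only [dotProduct, TrivSqZeroExt.fst_sum, TrivSqZeroExt.fst_mul, Pi.star_apply, fst_star,
    stdPart_apply, inner_eq_re_star_mul]
  exact re_sum _ _

theorem snd_rayleigh {n : ℕ} {A : Matrix (Fin n) (Fin n) DQ} {a : DualNumber ℝ} {x : Fin n → DQ}
    (h : ofDual a = star x ⬝ᵥ (A *ᵥ x)) : a.snd =
      inner ℝ (stdPart x) (stdOp A (dualPart x) + dualOp A (stdPart x)) +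
        inner ℝ (dualPart x) (stdOp A (stdPart x)) := by
  have h1 := congrArg (fun q : DQ => q.snd.re) h
  simp only [snd_ofDual, Quaternion.re_coe] at h1
  rw [h1, ← stdPart_mulVec, ← dualPart_mulVec, PiLp.inner_apply, PiLp.inner_apply,
    ← Finset.sum_add_distrib]
  simp only [dotProduct, TrivSqZeroExt.snd_sum, TrivSqZeroExt.snd_mul, Pi.star_apply, fst_star,
    snd_star, stdPart_apply, dualPart_apply, inner_eq_re_star_mul, smul_eq_mul,
    MulOpposite.smul_eq_mul_unop, MulOpposite.unop_op, ← Quaternion.re_add]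
  exact re_sum _ _

/-- If `A - a I` is invertible then so is its standard part. -/
theorem eq_zero_of_isUnit_shifted {n : ℕ} {A : Matrix (Fin n) (Fin n) DQ} {a : DualNumber ℝ}
    (h : IsUnit (shifted A a)) {x : QVec n} (hx : stdOp A x = a.fst • x) : x = 0 := by
  obtain ⟨U, hU⟩ := h
  -- On a purely dual vector `x ε` only the standard part of the matrix acts, so a standard kernel
  -- vector yields a dual quaternion kernel vector.
  have h1 : shifted A a *ᵥ ofParts 0 x = 0 := by
    rw [shifted_mulVec]
    refine ext_parts ?_ ?_
    · rw [stdPart_sub, stdPart_mulVec, stdPart_mul_ofDual]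
      simp
      rfl
    · rw [dualPart_sub, dualPart_mulVec, dualPart_mul_ofDual]
      simp [hx]
      rfl
  have h2 : ofParts 0 x = 0 := by
    have h3 : (U⁻¹ : (Matrix (Fin n) (Fin n) DQ)ˣ).1 *ᵥ (shifted A a *ᵥ ofParts 0 x) = 0 := by
      rw [h1, Matrix.mulVec_zero]
    rwa [Matrix.mulVec_mulVec, ← hU, Units.inv_mul, Matrix.one_mulVec] at h3
  rw [← dualPart_ofParts 0 x, h2]
  rfl

theorem tendsto_trivSqZeroExt {R : Type*} [AddCommMonoid R] [TopologicalSpace R] [ContinuousAdd R]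
    {f : ℕ → DualNumber R} {a : DualNumber R}
    (h₁ : Tendsto (fun k => (f k).fst) atTop (𝓝 a.fst))
    (h₂ : Tendsto (fun k => (f k).snd) atTop (𝓝 a.snd)) : Tendsto f atTop (𝓝 a) := by
  rw [TrivSqZeroExt.nhds_def]
  exact h₁.prodMk h₂

theorem tendsto_of_parts {n : ℕ} {f : ℕ → Fin n → DQ} {x : Fin n → DQ}
    (h₁ : Tendsto (fun k => stdPart (f k)) atTop (𝓝 (stdPart x)))
    (h₂ : Tendsto (fun k => dualPart (f k)) atTop (𝓝 (dualPart x))) : Tendsto f atTop (𝓝 x) := by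
  rw [tendsto_pi_nhds]
  intro i
  have hc : Continuous fun v : QVec n => v i := by fun_prop
  exact tendsto_trivSqZeroExt ((hc.tendsto _).comp h₁) ((hc.tendsto _).comp h₂)

end DQ

/-! ### Non-convergence up to unit quaternions, and reduction of the iteration to parts -/

namespace DQ

/-- Right multiplication of a quaternion vector by a quaternion. -/
noncomputable def rightMul {n : ℕ} (x : QVec n) (q : ℍ[ℝ]) : QVec n := WithLp.toLp 2 fun i => x i * q

@[simp] theorem rightMul_apply {n : ℕ} (x : QVec n) (q : ℍ[ℝ]) (i : Fin n) :
    rightMul x q i = x i * q := rfl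

theorem continuous_rightMul {n : ℕ} :
    Continuous fun z : QVec n × ℍ[ℝ] => rightMul z.1 z.2 := by
  unfold rightMul
  fun_prop

theorem matOp_rightMul {n : ℕ} (B : Matrix (Fin n) (Fin n) ℍ[ℝ]) (x : QVec n) (q : ℍ[ℝ]) :
    matOp B (rightMul x q) = rightMul (matOp B x) q := by
  ext i : 1
  simp [matOp_apply, Finset.sum_mul, mul_assoc]

theorem rightMul_sub {n : ℕ} (x y : QVec n) (q : ℍ[ℝ]) :
    rightMul (x - y) q = rightMul x q - rightMul y q := by
  ext i : 1
  simp [sub_mul]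

theorem rightMul_smul {n : ℕ} (c : ℝ) (x : QVec n) (q : ℍ[ℝ]) :
    rightMul (c • x) q = c • rightMul x q := by
  ext i : 1
  simp

theorem rightMul_rightMul {n : ℕ} (x : QVec n) (p q : ℍ[ℝ]) :
    rightMul (rightMul x p) q = rightMul x (p * q) := by
  ext i : 1
  simp [mul_assoc]

theorem self_mul_star_of_norm {q : ℍ[ℝ]} (hq : ‖q‖ = 1) : q * star q = 1 := by
  rw [Quaternion.self_mul_star, Quaternion.normSq_eq_norm_mul_self, hq]
  simp

theorem inner_rightMul {n : ℕ} (x y : QVec n) {q : ℍ[ℝ]} (hq : ‖q‖ = 1) :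
    inner ℝ (rightMul x q) (rightMul y q) = inner ℝ x y := by
  simp only [PiLp.inner_apply, rightMul_apply]
  refine Finset.sum_congr rfl fun i _ => ?_
  rw [Quaternion.inner_def, Quaternion.inner_def, star_mul, mul_assoc, ← mul_assoc q,
    self_mul_star_of_norm hq, one_mul]

/-- Iterates whose residuals stay away from zero do not converge, not even up to unit
quaternions. -/
theorem not_tendsto_rightMul {n : ℕ} {B : Matrix (Fin n) (Fin n) ℍ[ℝ]}
    {A₁ : QVec n →ₗ[ℝ] QVec n} {u v : ℕ → QVec n} {θ η N M : ℕ → ℝ} {C t τ : ℝ}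
    (h : DualRQI (matOp B) A₁ u v θ η N M C) (hτ : 0 < τ) (hθ : Tendsto θ atTop (𝓝 t))
    (hN : Tendsto (fun k => (N k)⁻¹) atTop (𝓝 τ))
    (hdef : Tendsto (fun k => matOp B (u k) - θ k • u k - (N k)⁻¹ • u (k + 1)) atTop (𝓝 0))
    (q : ℕ → ℍ[ℝ]) (hq : ∀ k, ‖q k‖ = 1) (x : QVec n) :
    ¬ Tendsto (fun k => rightMul (u k) (q k)) atTop (𝓝 x) := by
  intro hx
  have hB : Continuous (matOp B) := LinearMap.continuous_of_finiteDimensional _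
  set y := matOp B x - t • x with hy
  have hxs := (tendsto_add_atTop_iff_nat 1).2 hx
  have hyl : Tendsto (fun k => rightMul (matOp B (u k) - θ k • u k) (q k)) atTop (𝓝 y) := by
    refine (((hB.tendsto x).comp hx).sub (hθ.smul hx)).congr fun k => ?_
    simp only [Function.comp]
    rw [rightMul_sub, rightMul_smul, matOp_rightMul]
  have hylnext : Tendsto (fun k => rightMul (matOp B (u (k + 1)) - θ k • u (k + 1)) (q (k + 1)))
      atTop (𝓝 y) := by
    refine (((hB.tendsto x).comp hxs).sub (hθ.smul hxs)).congr fun k => ?_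
    simp only [Function.comp]
    rw [rightMul_sub, rightMul_smul, matOp_rightMul]
  -- the limit is orthogonal to its residual
  have hxn : inner ℝ x x = (1 : ℝ) := by
    refine tendsto_nhds_unique (hx.inner hx) (tendsto_const_nhds.congr fun k => ?_)
    rw [inner_rightMul _ _ (hq k), real_inner_self_eq_norm_sq, h.unit, one_pow]
  have hxy : inner ℝ x y = (0 : ℝ) := by
    refine tendsto_nhds_unique (hx.inner hyl) (tendsto_const_nhds.congr fun k => ?_)
    rw [inner_rightMul _ _ (hq k), inner_sub_right, inner_smul_right, real_inner_self_eq_norm_sq,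
      h.unit, ← h.theta_eq]
    ring
  have hpmem : ∀ k, star (q k) * q (k + 1) ∈ Metric.sphere (0 : ℍ[ℝ]) 1 := fun k => by
    rw [mem_sphere_zero_iff_norm, norm_mul, norm_star, hq, hq, one_mul]
  -- The `q k` need not converge; by compactness the relative rotations between consecutive iterates
  -- do along a subsequence.
  obtain ⟨p, hp, φ, hφ, hlim⟩ := (isCompact_sphere (0 : ℍ[ℝ]) 1).tendsto_subseq hpmem
  have hφ' := hφ.tendsto_atTop
  have hmul : ∀ {z : ℕ → QVec n} {w : QVec n}, Tendsto z atTop (𝓝 w) →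
      Tendsto (fun k => rightMul (z (φ k)) (star (q (φ k)) * q (φ k + 1))) atTop
        (𝓝 (rightMul w p)) := fun hz =>
    (continuous_rightMul.tendsto _).comp ((hz.comp hφ').prodMk_nhds hlim)
  have hcancel : ∀ k, q k * (star (q k) * q (k + 1)) = q (k + 1) := fun k => by
    rw [← mul_assoc, self_mul_star_of_norm (hq k), one_mul]
  have h1 : y = τ • rightMul x p := by
    refine tendsto_nhds_unique (hylnext.comp hφ')
      (((hN.comp hφ').smul (hmul hx)).congr fun k => ?_)
    simp only [Function.comp]
    rw [rightMul_rightMul, hcancel, ← rightMul_smul]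
    congr 1
    rw [inv_smul_eq_iff₀ (h.pos _).ne', h.step_u]
  have h2 : rightMul y p = τ • x := by
    have h3 : Tendsto (fun k => rightMul (matOp B (u k) - θ k • u k - (N k)⁻¹ • u (k + 1))
        (q (k + 1))) atTop (𝓝 0) := by
      rw [tendsto_zero_iff_norm_tendsto_zero] at hdef ⊢
      refine hdef.congr fun k => ?_
      rw [norm_eq_sqrt_real_inner, norm_eq_sqrt_real_inner, inner_rightMul _ _ (hq _)]
    have h4 := (h3.add (hN.smul hxs)).comp hφ'
    rw [zero_add] at h4
    refine tendsto_nhds_unique (hmul hyl) (h4.congr fun k => ?_)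
    simp only [Function.comp]
    rw [rightMul_rightMul, hcancel, ← rightMul_smul, rightMul_sub _ _ (q (φ k + 1)),
      sub_add_cancel]
  -- From `y = τ x p` and `y p = τ x` the four terms cancel in pairs. Since quaternions have no zero
  -- divisors, either `p = 1` or `y = -τ x`.
  have h5 : ∀ i, (y i + τ • x i) * (1 - p) = 0 := fun i => by
    have e1 : y i = τ • (x i * p) := congrArg (fun z : QVec n => z i) h1
    have e2 : y i * p = τ • x i := congrArg (fun z : QVec n => z i) h2
    rw [mul_sub, mul_one, add_mul, e2, smul_mul_assoc, ← e1]
    abel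
  have h6 : y = τ • x ∨ y = -(τ • x) := by
    by_cases hp1 : p = 1
    · left
      rw [h1, hp1]
      congr 1
      ext i : 1
      simp
    · right
      ext i : 1
      have := (mul_eq_zero.1 (h5 i)).resolve_right (sub_ne_zero.2 (Ne.symm hp1))
      exact eq_neg_of_add_eq_zero_left this
  rcases h6 with h6 | h6 <;> rw [h6] at hxy <;>
    simp only [inner_neg_right, inner_smul_right, hxn, mul_one] at hxy <;> linarith

/-- One regular step of the Rayleigh quotient iteration, in standard and dual parts. -/
theorem exists_normalization {n : ℕ} {A : Matrix (Fin n) (Fin n) DQ} {a : DualNumber ℝ}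
    {x w : Fin n → DQ} (hx : norm2 x = 1) (hw : shifted A a *ᵥ w = x) :
    ∃ r s : ℝ, 0 < r ∧ norm2 (fun i => w i * ofDual (norm2 w)⁻¹) = 1 ∧
      stdPart w = r • stdPart (fun i => w i * ofDual (norm2 w)⁻¹) ∧
      dualPart w = r • dualPart (fun i => w i * ofDual (norm2 w)⁻¹) +
        s • stdPart (fun i => w i * ofDual (norm2 w)⁻¹) := by
  have hw0 : stdPart w ≠ 0 := by
    intro h0
    have h1 := congrArg stdPart hw
    rw [shifted_mulVec, stdPart_sub, stdPart_mulVec, stdPart_mul_ofDual, h0] at h1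
    have h2 := (norm2_eq_one_iff.1 hx).1
    rw [← h1] at h2
    simp at h2
  have happ := appreciable_iff.2 hw0
  have hpos : 0 < ‖stdPart w‖ := norm_pos_iff.2 hw0
  have e1 := fst_norm2 happ
  have e2 := snd_norm2 happ
  have f1 : ((norm2 w)⁻¹).fst = ‖stdPart w‖⁻¹ := by rw [TrivSqZeroExt.fst_inv, e1]
  have f2 : ((norm2 w)⁻¹).snd =
      -(‖stdPart w‖⁻¹ * (inner ℝ (stdPart w) (dualPart w) / ‖stdPart w‖) * ‖stdPart w‖⁻¹) := by
    rw [TrivSqZeroExt.snd_inv, e1, e2]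
    simp only [smul_eq_mul, MulOpposite.smul_eq_mul_unop, MulOpposite.unop_op]
  -- The witnesses are the standard and dual parts of `norm2 w`.
  refine ⟨‖stdPart w‖, inner ℝ (stdPart w) (dualPart w) / ‖stdPart w‖, hpos, ?_, ?_, ?_⟩
  · rw [norm2_eq_one_iff, stdPart_mul_ofDual, dualPart_mul_ofDual, f1, f2]
    refine ⟨by rw [norm_smul, norm_inv, norm_norm, inv_mul_cancel₀ hpos.ne'], ?_⟩
    simp only [inner_add_right, inner_smul_left, inner_smul_right, conj_trivial,
      real_inner_self_eq_norm_sq]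
    field_simp
    ring
  · rw [stdPart_mul_ofDual, f1, smul_smul, mul_inv_cancel₀ hpos.ne', one_smul]
  · rw [stdPart_mul_ofDual, dualPart_mul_ofDual, f1, f2]
    simp only [smul_add, smul_smul]
    rw [mul_inv_cancel₀ hpos.ne', one_smul, add_assoc, ← add_smul]
    have : ‖stdPart w‖ * -(‖stdPart w‖⁻¹ * (inner ℝ (stdPart w) (dualPart w) / ‖stdPart w‖) *
        ‖stdPart w‖⁻¹) + inner ℝ (stdPart w) (dualPart w) / ‖stdPart w‖ * ‖stdPart w‖⁻¹ = 0 := by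
      field_simp
      ring
    rw [this, zero_smul, add_zero]

/-- A Rayleigh quotient iteration without singular steps, in standard and dual parts. -/
theorem IsRQI.exists_dualRQI {n : ℕ} {A : Matrix (Fin n) (Fin n) DQ} {θ : ℕ → DualNumber ℝ}
    {u : ℕ → Fin n → DQ} (h : IsRQI A θ u) (hA : A.IsHermitian)
    (hreg : ∀ k, IsUnit (shifted A (θ k))) {C : ℝ} (hC : ∀ k, norm2R (u k) ≤ C) :
    ∃ N M : ℕ → ℝ, DualRQI (stdOp A) (dualOp A) (fun k => stdPart (u k))
      (fun k => dualPart (u k)) (fun k => (θ k).fst) (fun k => (θ k).snd) N M C := by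
  choose w hw hu using fun k => h.step k (hreg k)
  have hunit : ∀ k, norm2 (u k) = 1 := by
    intro k
    induction k with
    | zero => exact h.start
    | succ k ih =>
      obtain ⟨_, _, _, h1, _⟩ := exists_normalization ih (hw k)
      rw [hu k]
      exact h1
  choose N M hN _ hstd hdual using fun k => exists_normalization (hunit k) (hw k)
  simp only [← hu] at hstd hdual
  refine ⟨N, M, fun k => (norm2_eq_one_iff.1 (hunit k)).1, fun k => (norm2_eq_one_iff.1 (hunit k)).2,
    fun k => fst_rayleigh (h.rayleigh k), fun k => ?_, hN,
    fun k x hx => eq_zero_of_isUnit_shifted (hreg k) hx, fun k => ?_, fun k => ?_,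
    fun k => (norm_dualPart_le _).trans (hC k)⟩
  · rw [snd_rayleigh (h.rayleigh k), inner_add_right, ← stdOp_isSymmetric hA,
      real_inner_comm (dualPart (u k))]
    ring
  · have h1 := congrArg stdPart (hw k)
    rw [shifted_mulVec, stdPart_sub, stdPart_mulVec, stdPart_mul_ofDual, hstd, map_smul] at h1
    rw [← h1]
    module
  · have h1 := congrArg dualPart (hw k)
    rw [shifted_mulVec, dualPart_sub, dualPart_mulVec, dualPart_mul_ofDual, hdual, hstd, map_add,
      map_smul, map_smul, map_smul] at h1
    rw [← h1]
    module

/-- A singular step reaches an eigenpair. -/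
theorem IsRQI.eigenpair_of_singular {n : ℕ} {A : Matrix (Fin n) (Fin n) DQ}
    {θ : ℕ → DualNumber ℝ} {u : ℕ → Fin n → DQ} (h : IsRQI A θ u) {k : ℕ}
    (hk : ¬ IsUnit (shifted A (θ k))) :
    IsEigenpair A (θ k) (u (k + 1)) ∧ norm2 (u (k + 1)) = 1 ∧
      ∀ m, k + 1 ≤ m → u m = u (k + 1) ∧ θ m = θ k := by
  obtain ⟨h0, h1, hconst⟩ := h.singularStep k hk
  obtain ⟨g1, g2⟩ := norm2_eq_one_iff.1 h1
  have heig : IsEigenpair A (θ k) (u (k + 1)) := by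
    refine ⟨appreciable_iff.2 fun h2 => by simp [h2] at g1, ?_⟩
    rwa [shifted_mulVec, sub_eq_zero] at h0
  obtain ⟨-, e1, e2⟩ := isEigenpair_iff.1 heig
  refine ⟨heig, h1, fun m hm => ⟨hconst m hm, ?_⟩⟩
  -- The Rayleigh quotient of a unit eigenvector is its eigenvalue, so every later shift equals `θ
  -- k`.
  have hr := h.rayleigh m
  rw [hconst m hm] at hr
  refine TrivSqZeroExt.ext ?_ ?_
  · rw [fst_rayleigh hr, e1, inner_smul_right, real_inner_self_eq_norm_sq, g1]
    ring
  · rw [snd_rayleigh hr, e1, e2, inner_add_right, inner_smul_right, inner_smul_right,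
      inner_smul_right, real_inner_self_eq_norm_sq, real_inner_comm (stdPart (u (k + 1))), g1, g2]
    ring

end DQ

/-! ### Equidistance and the conclusion -/

/-- The differences have standard parts `-τ` and `τ`, so the sign in the dual absolute value flips
only the first dual part; at the midpoint the dual parts then agree. -/
theorem dualAbs_midpoint {t τ a b : ℝ} (hτ : 0 < τ) {z x y : DualNumber ℝ}
    (hz : z.fst = t) (hz' : z.snd = (a + b) / 2) (hx : x.fst = t + τ) (hx' : x.snd = a)
    (hy : y.fst = t - τ) (hy' : y.snd = b) : dualAbs (z - x) = dualAbs (z - y) := by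
  have h1 : (z - x).fst = -τ := by rw [TrivSqZeroExt.fst_sub, hz, hx]; ring
  have h2 : (z - y).fst = τ := by rw [TrivSqZeroExt.fst_sub, hz, hy]; ring
  rw [dualAbs, dualAbs, if_pos (by rw [h1]; exact neg_ne_zero.2 hτ.ne'),
    if_pos (by rw [h2]; exact hτ.ne'), h1, h2, abs_neg, Real.sign_of_pos hτ,
    Real.sign_of_neg (neg_neg_of_pos hτ), TrivSqZeroExt.snd_sub, TrivSqZeroExt.snd_sub, hz', hx',
    hy']
  congr 2
  ring

theorem theorem4p4 {n : ℕ} (A : Matrix (Fin n) (Fin n) DQ) (hA : A.IsHermitian)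
    (θ : ℕ → DualNumber ℝ) (u : ℕ → Fin n → DQ) (hRQI : DQ.IsRQI A θ u)
    (hproper : ∃ C : ℝ, ∀ k, DQ.norm2R (u k) ≤ C) :
    (∃ (lam : DualNumber ℝ) (x : Fin n → DQ),
        DQ.IsEigenpair A lam x ∧ DQ.norm2 x = 1 ∧ Tendsto θ atTop (𝓝 lam) ∧
        ∃ s : ℕ → DQ, (∀ k, s k = 1 ∨ s k = -1) ∧
          Tendsto (fun k i => u k i * s k) atTop (𝓝 x)) ∨
    (∃ θ' lam₁ lam₂ : DualNumber ℝ,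
        Tendsto θ atTop (𝓝 θ') ∧
        DQ.IsEigenvalue A lam₁ ∧ DQ.IsEigenvalue A lam₂ ∧ lam₁.fst ≠ lam₂.fst ∧
        dualAbs (θ' - lam₁) = dualAbs (θ' - lam₂) ∧
        ¬ ∃ (q : ℕ → DQ) (x : Fin n → DQ), (∀ k, DQ.IsUnitDQ (q k)) ∧
          Tendsto (fun k i => u k i * q k) atTop (𝓝 x)) := by
  by_cases hreg : ∀ k, IsUnit (DQ.shifted A (θ k))
  swap
  · left
    obtain ⟨k, hk⟩ := not_forall.1 hreg
    obtain ⟨heig, hunit, hconst⟩ := hRQI.eigenpair_of_singular hk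
    refine ⟨θ k, u (k + 1), heig, hunit, ?_, fun _ => 1, fun _ => Or.inl rfl, ?_⟩
    · refine tendsto_const_nhds.congr' ?_
      filter_upwards [eventually_ge_atTop (k + 1)] with m hm
      exact (hconst m hm).2.symm
    · refine tendsto_const_nhds.congr' ?_
      filter_upwards [eventually_ge_atTop (k + 1)] with m hm
      simp only [mul_one]
      exact (hconst m hm).1.symm
  obtain ⟨C, hC⟩ := hproper
  obtain ⟨N, M, h⟩ := hRQI.exists_dualRQI hA hreg hC
  rcases h.dichotomy (DQ.stdOp_isSymmetric hA) (DQ.dualOp_isSymmetric hA) with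
    ⟨t, nu, x, y, s, hs, ht, hnu, hx, hy, hex, hey⟩ |
    ⟨t, τ, nu₁, nu₂, x₁, y₁, x₂, y₂, hτ, ht, hη, hx₁, hex₁, hey₁, hx₂, hex₂, hey₂, hN, hdef⟩
  · left
    have hx1 : ‖x‖ = 1 := by
      refine tendsto_nhds_unique hx.norm (tendsto_const_nhds.congr fun k => ?_)
      rw [norm_smul, h.unit k, mul_one]
      rcases hs k with h | h <;> rw [h] <;> norm_num
    have hxy : inner ℝ x y = (0 : ℝ) := by
      refine tendsto_nhds_unique (hx.inner hy) (tendsto_const_nhds.congr fun k => ?_)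
      rw [inner_smul_left, inner_smul_right, h.orth k]
      simp
    have hx0 : x ≠ 0 := fun h0 => by simp [h0] at hx1
    refine ⟨TrivSqZeroExt.inl t + TrivSqZeroExt.inr nu, DQ.ofParts x y, ?_, ?_, ?_,
      fun k => DQ.ofDual (TrivSqZeroExt.inl (s k)), fun k => ?_, ?_⟩
    · rw [DQ.isEigenpair_iff]
      simpa using ⟨hx0, hex, hey⟩
    · rw [DQ.norm2_eq_one_iff]
      simpa using ⟨hx1, hxy⟩
    · exact DQ.tendsto_trivSqZeroExt (by simpa using ht) (by simpa using hnu)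
    · rcases hs k with h | h
      · left
        simp only [h]
        refine TrivSqZeroExt.ext ?_ ?_ <;> simp
      · right
        simp only [h]
        refine TrivSqZeroExt.ext ?_ ?_ <;> simp
    · refine DQ.tendsto_of_parts ?_ ?_
      · simpa [DQ.stdPart_mul_ofDual] using hx
      · simpa [DQ.dualPart_mul_ofDual] using hy
  · right
    refine ⟨TrivSqZeroExt.inl t + TrivSqZeroExt.inr ((nu₁ + nu₂) / 2),
      TrivSqZeroExt.inl (t + τ) + TrivSqZeroExt.inr nu₁,
      TrivSqZeroExt.inl (t - τ) + TrivSqZeroExt.inr nu₂,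
      DQ.tendsto_trivSqZeroExt (by simpa using ht) (by simpa using hη),
      ⟨DQ.ofParts x₁ y₁, DQ.isEigenpair_iff.2 ?_⟩, ⟨DQ.ofParts x₂ y₂, DQ.isEigenpair_iff.2 ?_⟩,
      ?_, ?_, ?_⟩
    · simpa using ⟨hx₁, hex₁, hey₁⟩
    · simpa using ⟨hx₂, hex₂, hey₂⟩
    · simp only [TrivSqZeroExt.fst_add, TrivSqZeroExt.fst_inl, TrivSqZeroExt.fst_inr, add_zero]
      intro h0
      linarith
    · exact dualAbs_midpoint (a := nu₁) (b := nu₂) (t := t) hτ (by simp) (by simp) (by simp)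
        (by simp) (by simp) (by simp)
    · rintro ⟨q, x, hq, hlim⟩
      -- Divergence already occurs in the standard parts, where a unit dual quaternion acts as a
      -- unit quaternion.
      refine DQ.not_tendsto_rightMul h hτ ht hN hdef (fun k => (q k).fst) (fun k => (hq k).1)
        (DQ.stdPart x) ?_
      have hc : Continuous (DQ.stdPart : (Fin n → DQ) → DQ.QVec n) := by
        unfold DQ.stdPart
        have := TrivSqZeroExt.continuous_fst (R := ℍ[ℝ]) (M := ℍ[ℝ])
        fun_prop
      refine ((hc.tendsto x).comp hlim).congr fun k => ?_
      ext i : 1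
      simp
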